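/- Let $\alpha\in(1,2)$, $\beta>0$ and $C_0>0$, and let $J$ be a symmetric real random variable (that is, $J$ and $-J$ have the same distribution) with $$\mathbb P(|J|\ge t)=\frac{C_0}{t^{\alpha}}\qquad\text{for all } t>1 .$$ For each $N\ge 1$ let $(J_{ij})_{1\le i<j\le N}$ be independent random variables with the same distribution as $J$, and define $$H_N(\sigma)=\frac1{N^{1/\alpha}}\sum_{1\le i<j\le N}J_{ij}\sigma_i\sigma_j\quad(\sigma\in\{-1,+1\}^N),\qquad Z_N(\beta)=\sum_{\sigma\in\{-1,+1\}^N}e^{\beta H_N(\sigma)},\qquad F_N(\beta)=\frac1N\,\mathbb E\big[\log Z_N(\beta)\big].$$ Then $\log Z_N(\beta)$ is integrable for every $N$, and the limit $\lim_{N\to\infty}F_N(\beta)$ exists and is finite. -/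

import Mathlib

open MeasureTheory ProbabilityTheory Filter Topology

noncomputable section

namespace HeavyTailedSpinGlass

/-- The pairs `(i, j)` of sites with `i < j`. -/
abbrev Pairs (N : ℕ) : Type := {p : Fin N × Fin N // p.1 < p.2}

/-- Spin configurations `Σ_N = {-1, +1}^N`; the units of `ℤ` are exactly `-1` and `1`. -/
abbrev Config (N : ℕ) : Type := Fin N → ℤˣ

/-- The value `±1` of the spin at site `i`, as a real number. -/
def spin {N : ℕ} (σ : Config N) (i : Fin N) : ℝ := ((σ i : ℤ) : ℝ)

/-- The Hamiltonian `H(σ) = N^{-1/α} ∑_{i<j} J_{ij} σ_i σ_j`. -/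
def hamiltonian (α : ℝ) {N : ℕ} (J : Pairs N → ℝ) (σ : Config N) : ℝ :=
  1 / (N : ℝ) ^ (1 / α) * ∑ p : Pairs N, J p * spin σ p.1.1 * spin σ p.1.2

/-- The partition function `Z_N(β) = ∑_σ exp (β H(σ))`. -/
def partitionFunction (α β : ℝ) {N : ℕ} (J : Pairs N → ℝ) : ℝ :=
  ∑ σ : Config N, Real.exp (β * hamiltonian α J σ)

/-- The quenched free energy `F_N(β) = N⁻¹ 𝔼[log Z_N(β)]` for random couplings `J`. -/
def freeEnergy (α β : ℝ) {N : ℕ} {Ω : Type*} [MeasurableSpace Ω] (P : Measure Ω)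
    (J : Pairs N → Ω → ℝ) : ℝ :=
  1 / (N : ℝ) * ∫ ω, Real.log (partitionFunction α β (fun p => J p ω)) ∂P

end HeavyTailedSpinGlass

end

noncomputable section

namespace HeavyTailedSpinGlass

/-! ### The partition function as a function of the couplings -/

/-! Cut the scaled couplings `β N^{-1/α} J` at a level `δ`: the small ones hardly matter, and the
large ones form a sparse random graph for which interpolation gives almost superadditivity.

Small couplings. Averaged over its sign, a coupling `y` between spins of Gibbs correlation `m`
raises `log Z` by `gain y m`, which lies between `0` and `y ^ 2 / 2`. There are at most `N ^ 2`
pairs, and each truncated second moment is of order `δ ^ (2 - α) / N`. Removing the small couplings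
therefore moves the free energy per site by order `δ ^ (2 - α)`, uniformly in `N`; this is where `α
< 2` enters (`abs_integral_logZ_sub_trunc_le`, `integral_sub_trunc_sq_le`).

Large couplings. Since the tail is an exact power, for large `N` a scaled coupling exceeds `δ` in
modulus with probability exactly `c / N`, where `c = C₀ (β / δ) ^ α`, and its conditional law `μ`
does not depend on `N` (`exists_scaledLaw_map_trunc_eq_mixture`). What remains is a diluted spin
glass.

Diluted model. Interpolate the edge probabilities from two decoupled blocks of sizes `m` and `n` to
the homogeneous system of size `m + n`. By Russo's formula the derivative is a sum of mean gains
weighted by the change of the probabilities. That change is `-K u_i u_j` with `K ≥ 0` and `∑ u_i =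
0`. Expanding the logarithm, `gain` is a constant minus a positive series in even powers of the
correlation. Replicas show that the matrices of such powers are positive semidefinite, so the gain
is conditionally negative semidefinite and the derivative is nonnegative up to a bounded error
(`sum_mul_gain_nonpos`, `bernoulliMean_maskedMean_le`). Fekete's lemma then yields a limit for each
`δ`.

Conclusion. The free energies are approximated, eventually and to any accuracy, by convergent
sequences, hence are Cauchy. -/

lemma spin_eq_one_or {N : ℕ} (σ : Config N) (i : Fin N) : spin σ i = 1 ∨ spin σ i = -1 := by
  rcases Int.units_eq_one_or (σ i) with h | h <;> simp [spin, h]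

lemma spin_mul_self {N : ℕ} (σ : Config N) (i : Fin N) : spin σ i * spin σ i = 1 := by
  rcases spin_eq_one_or σ i with h | h <;> simp [h]

lemma spin_mul_spin_eq_one_or {N : ℕ} (σ : Config N) (i j : Fin N) :
    spin σ i * spin σ j = 1 ∨ spin σ i * spin σ j = -1 := by
  rcases spin_eq_one_or σ i with h | h <;> rcases spin_eq_one_or σ j with h' | h' <;> simp [h, h']

lemma abs_spin_mul_spin {N : ℕ} (σ : Config N) (i j : Fin N) : |spin σ i * spin σ j| = 1 := by
  rcases spin_mul_spin_eq_one_or σ i j with h | h <;> simp [h]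

/-- The energy `∑_{i<j} x_{ij} σ_i σ_j`, without normalization. -/
def energy {N : ℕ} (x : Pairs N → ℝ) (σ : Config N) : ℝ :=
  ∑ p : Pairs N, x p * (spin σ p.1.1 * spin σ p.1.2)

/-- The logarithm of `∑_σ exp (∑_{i<j} x_{ij} σ_i σ_j)`. -/
def logZ {N : ℕ} (x : Pairs N → ℝ) : ℝ := Real.log (∑ σ : Config N, Real.exp (energy x σ))

lemma log_partitionFunction (α β : ℝ) {N : ℕ} (J : Pairs N → ℝ) :
    Real.log (partitionFunction α β J) = logZ (fun p => β / (N : ℝ) ^ (1 / α) * J p) := by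
  unfold partitionFunction logZ energy hamiltonian
  congr 1
  refine Finset.sum_congr rfl fun σ _ => ?_
  congr 1
  rw [Finset.mul_sum, Finset.mul_sum]
  refine Finset.sum_congr rfl fun p _ => ?_
  ring

lemma sum_exp_energy_pos {N : ℕ} (x : Pairs N → ℝ) :
    0 < ∑ σ : Config N, Real.exp (energy x σ) :=
  Finset.sum_pos (fun _ _ => Real.exp_pos _) Finset.univ_nonempty

lemma abs_energy_le {N : ℕ} (x : Pairs N → ℝ) (σ : Config N) : |energy x σ| ≤ ∑ p, |x p| := by
  refine (Finset.abs_sum_le_sum_abs _ _).trans (Finset.sum_le_sum fun p _ => ?_)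
  rw [abs_mul, abs_spin_mul_spin, mul_one]

lemma card_config (N : ℕ) : (Fintype.card (Config N) : ℝ) = 2 ^ N := by
  simp [Config]

/-- There are `2 ^ N` configurations, each of energy between `±∑ |x p|`. This crude bound supplies
both the integrability of `logZ` and the linear upper bound for Fekete's lemma. -/
lemma abs_logZ_sub_le {N : ℕ} (x : Pairs N → ℝ) : |logZ x - N * Real.log 2| ≤ ∑ p, |x p| := by
  have hlog : (N : ℝ) * Real.log 2 = Real.log (2 ^ N) := by rw [Real.log_pow]
  have h2 : (0 : ℝ) < 2 ^ N := by positivity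
  have hpos := sum_exp_energy_pos x
  have hsum : ∀ s : ℝ, ∑ _σ : Config N, Real.exp s = 2 ^ N * Real.exp s := fun s => by
    rw [Finset.sum_const, Finset.card_univ, nsmul_eq_mul, card_config]
  rw [hlog, abs_le]
  constructor
  · have h : 2 ^ N * Real.exp (-∑ p, |x p|) ≤ ∑ σ : Config N, Real.exp (energy x σ) := by
      rw [← hsum]
      exact Finset.sum_le_sum fun σ _ =>
        Real.exp_le_exp.2 (abs_le.1 (abs_energy_le x σ)).1
    have h' := Real.log_le_log (by positivity) h
    rw [Real.log_mul h2.ne' (Real.exp_pos _).ne', Real.log_exp] at h'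
    unfold logZ
    linarith
  · have h : ∑ σ : Config N, Real.exp (energy x σ) ≤ 2 ^ N * Real.exp (∑ p, |x p|) := by
      rw [← hsum]
      exact Finset.sum_le_sum fun σ _ =>
        Real.exp_le_exp.2 (abs_le.1 (abs_energy_le x σ)).2
    have h' := Real.log_le_log hpos h
    rw [Real.log_mul h2.ne' (Real.exp_pos _).ne', Real.log_exp] at h'
    unfold logZ
    linarith

lemma continuous_energy {N : ℕ} (σ : Config N) :
    Continuous fun x : Pairs N → ℝ => energy x σ := by
  unfold energy
  fun_prop

lemma continuous_logZ {N : ℕ} : Continuous (logZ (N := N)) := by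
  unfold logZ
  refine Continuous.log ?_ fun x => (sum_exp_energy_pos x).ne'
  exact continuous_finsetSum _ fun σ _ => Real.continuous_exp.comp (continuous_energy σ)

/-- The Gibbs average of `σ_i σ_j`. -/
def gibbs {N : ℕ} (x : Pairs N → ℝ) (i j : Fin N) : ℝ :=
  (∑ σ : Config N, Real.exp (energy x σ) * (spin σ i * spin σ j)) /
    ∑ σ : Config N, Real.exp (energy x σ)

lemma continuous_gibbs {N : ℕ} (i j : Fin N) :
    Continuous fun x : Pairs N → ℝ => gibbs x i j := by
  unfold gibbs
  refine Continuous.div ?_ ?_ fun x => (sum_exp_energy_pos x).ne'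
  · exact continuous_finsetSum _ fun σ _ =>
      (Real.continuous_exp.comp (continuous_energy σ)).mul continuous_const
  · exact continuous_finsetSum _ fun σ _ => Real.continuous_exp.comp (continuous_energy σ)

lemma gibbs_comm {N : ℕ} (x : Pairs N → ℝ) (i j : Fin N) : gibbs x i j = gibbs x j i := by
  unfold gibbs
  simp only [mul_comm (spin _ i)]

lemma gibbs_self {N : ℕ} (x : Pairs N → ℝ) (i : Fin N) : gibbs x i i = 1 := by
  unfold gibbs
  simp only [spin_mul_self, mul_one]
  exact div_self (sum_exp_energy_pos x).ne'

lemma abs_gibbs_le_one {N : ℕ} (x : Pairs N → ℝ) (i j : Fin N) : |gibbs x i j| ≤ 1 := by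
  unfold gibbs
  rw [abs_div, abs_of_pos (sum_exp_energy_pos x), div_le_one (sum_exp_energy_pos x)]
  refine (Finset.abs_sum_le_sum_abs _ _).trans_eq (Finset.sum_congr rfl fun σ _ => ?_)
  rw [abs_mul, abs_spin_mul_spin, mul_one, Real.abs_exp]

lemma energy_update {N : ℕ} (x : Pairs N → ℝ) (e : Pairs N) (y : ℝ) (σ : Config N) :
    energy (Function.update x e y) σ =
      energy (Function.update x e 0) σ + y * (spin σ e.1.1 * spin σ e.1.2) := by
  rw [← sub_eq_iff_eq_add']
  unfold energy
  rw [← Finset.sum_sub_distrib, Finset.sum_eq_single e]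
  · simp
  · intro p _ hp
    simp [hp]
  · simp

lemma exp_mul_spin_mul_spin {N : ℕ} (σ : Config N) (i j : Fin N) (y : ℝ) :
    Real.exp (y * (spin σ i * spin σ j)) =
      Real.cosh y + spin σ i * spin σ j * Real.sinh y := by
  rcases spin_mul_spin_eq_one_or σ i j with h | h
  · rw [h, mul_one, one_mul, Real.cosh_add_sinh]
  · rw [h, mul_neg_one, neg_one_mul, ← sub_eq_add_neg, Real.cosh_sub_sinh]

/-- The expression is a convex combination of `exp y` and `exp (-y)`, with weights `(1 ± m) / 2`. -/
lemma cosh_add_mul_sinh_pos {m : ℝ} (hm : |m| ≤ 1) (y : ℝ) :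
    0 < Real.cosh y + m * Real.sinh y := by
  have h1 := Real.cosh_add_sinh y
  have h2 := Real.cosh_sub_sinh y
  have h3 := Real.exp_pos y
  have h4 := Real.exp_pos (-y)
  have := abs_le.1 hm
  rcases lt_or_ge m 0 with h | h <;> nlinarith

/-- Switching on the coupling at one pair changes `logZ` by the logarithm of a Gibbs average. -/
lemma logZ_update {N : ℕ} (x : Pairs N → ℝ) (e : Pairs N) (y : ℝ) :
    logZ (Function.update x e y) = logZ (Function.update x e 0) +
      Real.log (Real.cosh y + gibbs (Function.update x e 0) e.1.1 e.1.2 * Real.sinh y) := by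
  have hZ := sum_exp_energy_pos (Function.update x e 0)
  have hpos := cosh_add_mul_sinh_pos (abs_gibbs_le_one (Function.update x e 0) e.1.1 e.1.2) y
  unfold logZ
  rw [← Real.log_mul hZ.ne' hpos.ne']
  congr 1
  have : ∀ σ : Config N, Real.exp (energy (Function.update x e y) σ) =
      Real.cosh y * Real.exp (energy (Function.update x e 0) σ) + Real.sinh y *
        (Real.exp (energy (Function.update x e 0) σ) * (spin σ e.1.1 * spin σ e.1.2)) :=
    fun σ => by
      rw [energy_update, Real.exp_add, exp_mul_spin_mul_spin]
      ring
  simp only [this]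
  rw [Finset.sum_add_distrib, ← Finset.mul_sum, ← Finset.mul_sum]
  unfold gibbs
  field_simp

/-! ### The symmetrized gain from a single coupling -/

/-- The effect on `logZ`, averaged over the sign, of a new coupling `±y` between two spins whose
Gibbs correlation is `m`. -/
def gain (y m : ℝ) : ℝ := Real.log (Real.cosh y) + Real.log (1 - Real.tanh y ^ 2 * m ^ 2) / 2

lemma tanh_sq_lt_one (y : ℝ) : Real.tanh y ^ 2 < 1 := by
  rw [sq_lt_one_iff_abs_lt_one]
  exact Real.abs_tanh_lt_one y

lemma tanh_sq_mul_sq_lt_one {m : ℝ} (hm : |m| ≤ 1) (y : ℝ) : Real.tanh y ^ 2 * m ^ 2 < 1 := by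
  have h1 := tanh_sq_lt_one y
  have h2 : m ^ 2 ≤ 1 := (sq_le_one_iff_abs_le_one m).2 hm
  nlinarith [sq_nonneg m, sq_nonneg (Real.tanh y)]

/-- The two arguments multiply to `cosh² y - m² sinh² y`, so `gain` is exactly the mean of the
increments for the couplings `y` and `-y`. -/
lemma log_add_log_eq_gain {m : ℝ} (hm : |m| ≤ 1) (y : ℝ) :
    Real.log (Real.cosh y + m * Real.sinh y) + Real.log (Real.cosh (-y) + m * Real.sinh (-y)) =
      2 * gain y m := by
  have h1 := cosh_add_mul_sinh_pos hm y
  have h2 := cosh_add_mul_sinh_pos hm (-y)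
  have hc := Real.cosh_pos y
  have ht := tanh_sq_mul_sq_lt_one hm y
  rw [← Real.log_mul h1.ne' h2.ne']
  have : (Real.cosh y + m * Real.sinh y) * (Real.cosh (-y) + m * Real.sinh (-y)) =
      Real.cosh y ^ 2 * (1 - Real.tanh y ^ 2 * m ^ 2) := by
    rw [Real.cosh_neg, Real.sinh_neg, Real.tanh_eq_sinh_div_cosh]
    field_simp
    ring
  rw [this, Real.log_mul (by positivity) (by linarith), Real.log_pow]
  unfold gain
  push_cast
  ring

lemma one_sub_tanh_sq (y : ℝ) : 1 - Real.tanh y ^ 2 = (Real.cosh y ^ 2)⁻¹ := by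
  have hc := Real.cosh_pos y
  rw [Real.tanh_eq_sinh_div_cosh]
  field_simp
  have := Real.cosh_sq y
  linarith

/-- At full correlation the increments for `y` and `-y` are `y` and `-y`, which cancel. Hence
diagonal terms vanish, and sums over pairs can be turned into full double sums. -/
lemma gain_one (y : ℝ) : gain y 1 = 0 := by
  unfold gain
  rw [one_pow, mul_one, one_sub_tanh_sq, Real.log_inv, Real.log_pow]
  push_cast
  ring

lemma gain_nonneg {m : ℝ} (hm : |m| ≤ 1) (y : ℝ) : 0 ≤ gain y m := by
  rw [← gain_one y]
  unfold gain
  have h2 : m ^ 2 ≤ 1 := (sq_le_one_iff_abs_le_one m).2 hm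
  have h := Real.log_le_log (x := 1 - Real.tanh y ^ 2 * 1 ^ 2) (y := 1 - Real.tanh y ^ 2 * m ^ 2)
    (by nlinarith [tanh_sq_lt_one y]) (by nlinarith [sq_nonneg (Real.tanh y)])
  simp only [one_pow, mul_one] at h ⊢
  linarith

lemma gain_le_log_cosh {m : ℝ} (hm : |m| ≤ 1) (y : ℝ) : gain y m ≤ Real.log (Real.cosh y) := by
  unfold gain
  have := Real.log_nonpos (x := 1 - Real.tanh y ^ 2 * m ^ 2)
    (by linarith [tanh_sq_mul_sq_lt_one hm y])
    (by nlinarith [mul_nonneg (sq_nonneg (Real.tanh y)) (sq_nonneg m)])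
  linarith

lemma gain_le_abs {m : ℝ} (hm : |m| ≤ 1) (y : ℝ) : gain y m ≤ |y| := by
  refine (gain_le_log_cosh hm y).trans ?_
  rw [Real.log_le_iff_le_exp (Real.cosh_pos y), ← Real.cosh_abs, ← Real.cosh_add_sinh |y|]
  linarith [Real.sinh_nonneg_iff.2 (abs_nonneg y)]

lemma gain_le_half_sq {m : ℝ} (hm : |m| ≤ 1) (y : ℝ) : gain y m ≤ y ^ 2 / 2 := by
  refine (gain_le_log_cosh hm y).trans ?_
  rw [Real.log_le_iff_le_exp (Real.cosh_pos y)]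
  exact Real.cosh_le_exp_half_sq y

/-! ### Conditional negativity of the gain -/

/-- Entrywise powers of the matrix of Gibbs correlations are positive semidefinite: expand in
replicas. -/
lemma sum_mul_gibbs_pow_nonneg {N : ℕ} (x : Pairs N → ℝ) (u : Fin N → ℝ) (n : ℕ) :
    0 ≤ ∑ i, ∑ j, u i * u j * gibbs x i j ^ n := by
  set w : Config N → ℝ := fun σ =>
    Real.exp (energy x σ) / ∑ σ : Config N, Real.exp (energy x σ) with hw
  have hw0 : ∀ σ, 0 ≤ w σ := fun σ => div_nonneg (Real.exp_pos _).le (sum_exp_energy_pos x).le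
  -- The `n`-th power of a Gibbs average is an average over `n` independent replicas, and its
  -- integrand factors into a function of `i` times the same function of `j`.
  have hg : ∀ i j, gibbs x i j ^ n = ∑ s : Fin n → Config N,
      (∏ a, w (s a)) * ((∏ a, spin (s a) i) * ∏ a, spin (s a) j) := fun i j => by
    have : gibbs x i j = ∑ σ, w σ * (spin σ i * spin σ j) := by
      unfold gibbs
      rw [Finset.sum_div]
      exact Finset.sum_congr rfl fun σ _ => by rw [hw]; ring
    rw [this, Fintype.sum_pow]
    simp only [Finset.prod_mul_distrib]
  have key : ∑ i, ∑ j, u i * u j * gibbs x i j ^ n = ∑ s : Fin n → Config N,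
      (∏ a, w (s a)) * (∑ i, u i * ∏ a, spin (s a) i) ^ 2 := by
    simp only [hg, Finset.mul_sum]
    have : ∀ i, ∑ j, ∑ s : Fin n → Config N, u i * u j * ((∏ a, w (s a)) *
        ((∏ a, spin (s a) i) * ∏ a, spin (s a) j)) = ∑ s : Fin n → Config N, ∑ j, u i * u j *
        ((∏ a, w (s a)) * ((∏ a, spin (s a) i) * ∏ a, spin (s a) j)) :=
      fun i => Finset.sum_comm
    simp only [this]
    rw [Finset.sum_comm]
    refine Finset.sum_congr rfl fun s _ => ?_
    rw [sq, Finset.sum_mul_sum, Finset.mul_sum]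
    refine Finset.sum_congr rfl fun i _ => ?_
    rw [Finset.mul_sum]
    refine Finset.sum_congr rfl fun j _ => ?_
    ring
  rw [key]
  exact Finset.sum_nonneg fun s _ =>
    mul_nonneg (Finset.prod_nonneg fun a _ => hw0 _) (sq_nonneg _)

/-- The matrix of gains is conditionally negative semidefinite. -/
lemma sum_mul_gain_nonpos {N : ℕ} (x : Pairs N → ℝ) (u : Fin N → ℝ) (hu : ∑ i, u i = 0) (y : ℝ) :
    ∑ i, ∑ j, u i * u j * gain y (gibbs x i j) ≤ 0 := by
  -- All coefficients of `-log (1 - z) = ∑ z ^ (n + 1) / (n + 1)` are positive, so positivity can be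
  -- checked term by term. The constant `log (cosh y)` is annihilated by `∑ u i = 0`.
  have hs : ∀ i j, HasSum (fun n : ℕ => u i * u j *
      ((Real.tanh y ^ 2 * gibbs x i j ^ 2) ^ (n + 1) / (n + 1)))
      (u i * u j * -Real.log (1 - Real.tanh y ^ 2 * gibbs x i j ^ 2)) := fun i j => by
    refine (Real.hasSum_pow_div_log_of_abs_lt_one ?_).mul_left _
    rw [abs_of_nonneg (by positivity)]
    exact tanh_sq_mul_sq_lt_one (abs_gibbs_le_one x i j) y
  have hs' := hasSum_sum (s := Finset.univ) fun i _ =>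
    hasSum_sum (s := Finset.univ) fun j _ => hs i j
  have h0 : 0 ≤ ∑ i, ∑ j, u i * u j * -Real.log (1 - Real.tanh y ^ 2 * gibbs x i j ^ 2) := by
    refine hs'.nonneg fun n => ?_
    have : ∑ i, ∑ j, u i * u j * ((Real.tanh y ^ 2 * gibbs x i j ^ 2) ^ (n + 1) / (n + 1)) =
        (Real.tanh y ^ 2) ^ (n + 1) / (n + 1) *
          ∑ i, ∑ j, u i * u j * gibbs x i j ^ (2 * (n + 1)) := by
      rw [Finset.mul_sum]
      refine Finset.sum_congr rfl fun i _ => ?_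
      rw [Finset.mul_sum]
      refine Finset.sum_congr rfl fun j _ => ?_
      rw [mul_pow, pow_mul (gibbs x i j)]
      ring
    rw [this]
    exact mul_nonneg (by positivity) (sum_mul_gibbs_pow_nonneg x u _)
  have h1 : ∑ i, ∑ j, u i * u j * gain y (gibbs x i j) =
      Real.log (Real.cosh y) * ((∑ i, u i) * ∑ j, u j) -
        (∑ i, ∑ j, u i * u j * -Real.log (1 - Real.tanh y ^ 2 * gibbs x i j ^ 2)) / 2 := by
    rw [Finset.sum_mul_sum, Finset.mul_sum, Finset.sum_div, ← Finset.sum_sub_distrib]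
    refine Finset.sum_congr rfl fun i _ => ?_
    rw [Finset.mul_sum, Finset.sum_div, ← Finset.sum_sub_distrib]
    refine Finset.sum_congr rfl fun j _ => ?_
    unfold gain
    ring
  rw [h1, hu]
  linarith

lemma sum_pairs_eq_half_sum {N : ℕ} (h : Fin N → Fin N → ℝ) (hsymm : ∀ i j, h i j = h j i)
    (hdiag : ∀ i, h i i = 0) : ∑ p : Pairs N, h p.1.1 p.1.2 = (∑ i, ∑ j, h i j) / 2 := by
  have h1 : ∑ p : Pairs N, h p.1.1 p.1.2 = ∑ i, ∑ j, if i < j then h i j else 0 := by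
    rw [← Fintype.sum_prod_type' (f := fun i j => if i < j then h i j else 0), ← Finset.sum_filter]
    exact (Finset.sum_subtype (p := fun p : Fin N × Fin N => p.1 < p.2) _ (by simp)
      (fun p => h p.1 p.2)).symm
  have h2 : ∑ i, ∑ j, (if i < j then h i j else 0) = ∑ i, ∑ j, if j < i then h i j else 0 := by
    rw [Finset.sum_comm]
    refine Finset.sum_congr rfl fun i _ => Finset.sum_congr rfl fun j _ => ?_
    rw [hsymm]
  have h3 : ∑ i, ∑ j, h i j = ∑ i, ∑ j, (if i < j then h i j else 0) +
      ∑ i, ∑ j, if j < i then h i j else 0 := by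
    rw [← Finset.sum_add_distrib]
    refine Finset.sum_congr rfl fun i _ => ?_
    rw [← Finset.sum_add_distrib]
    refine Finset.sum_congr rfl fun j _ => ?_
    rcases lt_trichotomy i j with hij | rfl | hij
    · simp [hij, hij.not_gt]
    · simp [hdiag]
    · simp [hij, hij.not_gt]
  rw [h1, h3, ← h2]
  ring

/-! ### Averages over independent couplings -/

/-- Resampling one coordinate preserves a product measure. -/
lemma measurePreserving_update {ι : Type*} [Fintype ι] [DecidableEq ι] (ν : Measure ℝ)
    [IsProbabilityMeasure ν] (e : ι) :
    MeasurePreserving (fun z : (ι → ℝ) × ℝ => Function.update z.1 e z.2)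
      ((Measure.pi fun _ : ι => ν).prod ν) (Measure.pi fun _ : ι => ν) := by
  have hm : Measurable fun z : (ι → ℝ) × ℝ => Function.update z.1 e z.2 := by
    refine measurable_pi_lambda _ fun i => ?_
    by_cases h : i = e
    · subst h; simpa using measurable_snd
    · simp only [Function.update_of_ne h]
      exact (measurable_pi_apply i).comp measurable_fst
  refine ⟨hm, (Measure.pi_eq fun s hs => ?_).symm⟩
  rw [Measure.map_apply hm (MeasurableSet.univ_pi hs)]
  have : (fun z : (ι → ℝ) × ℝ => Function.update z.1 e z.2) ⁻¹' Set.univ.pi s =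
      (Set.univ.pi (Function.update s e Set.univ)) ×ˢ s e := by
    ext ⟨x, y⟩
    simp only [Set.mem_preimage, Set.mem_pi, Set.mem_univ, true_imp_iff, Set.mem_prod]
    constructor
    · intro h
      refine ⟨fun i => ?_, by simpa using h e⟩
      by_cases hi : i = e
      · subst hi; simp
      · simpa [hi] using h i
    · rintro ⟨h, h'⟩ i
      by_cases hi : i = e
      · subst hi; simpa using h'
      · simpa [hi] using h i
  rw [this, Measure.prod_prod, Measure.pi_pi, ← Finset.mul_prod_erase _ _ (Finset.mem_univ e),
    ← Finset.mul_prod_erase Finset.univ (fun i => ν (s i)) (Finset.mem_univ e)]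
  simp only [Function.update_self, measure_univ, one_mul]
  rw [mul_comm]
  congr 1
  refine Finset.prod_congr rfl fun i hi => ?_
  rw [Function.update_of_ne (Finset.ne_of_mem_erase hi)]

lemma integral_pi_eq_integral_update {ι : Type*} [Fintype ι] [DecidableEq ι] (ν : Measure ℝ)
    [IsProbabilityMeasure ν] (e : ι) {F : (ι → ℝ) → ℝ}
    (hF : Integrable F (Measure.pi fun _ : ι => ν)) :
    ∫ x, F x ∂(Measure.pi fun _ : ι => ν) =
      ∫ x, ∫ y, F (Function.update x e y) ∂ν ∂(Measure.pi fun _ : ι => ν) := by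
  have hmp := measurePreserving_update ν e
  rw [← integral_prod (fun z : (ι → ℝ) × ℝ => F (Function.update z.1 e z.2))
    (hmp.integrable_comp_of_integrable hF)]
  have h := integral_map hmp.measurable.aemeasurable
    (f := F) (by rw [hmp.map_eq]; exact hF.aestronglyMeasurable)
  rwa [hmp.map_eq] at h

lemma integrable_abs_coord {ι : Type*} [Fintype ι] (ν : ι → Measure ℝ)
    [∀ p, IsProbabilityMeasure (ν p)] (hν : ∀ p, Integrable (fun y => y) (ν p)) (p : ι) :
    Integrable (fun x : ι → ℝ => |x p|) (Measure.pi ν) :=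
  integrable_comp_eval (X := fun _ : ι => ℝ) (μ := ν) (f := fun y : ℝ => |y|) (i := p) (hν p).abs

/-- The coordinatewise contractions `t p` cover at once the identity, truncation on a subset of
pairs, and masking. -/
lemma integrable_logZ_comp {N : ℕ} (ν : Pairs N → Measure ℝ) [∀ p, IsProbabilityMeasure (ν p)]
    (hν : ∀ p, Integrable (fun y => y) (ν p)) (t : Pairs N → ℝ → ℝ) (ht : ∀ p, Measurable (t p))
    (hle : ∀ p y, |t p y| ≤ |y|) :
    Integrable (fun x : Pairs N → ℝ => logZ fun p => t p (x p)) (Measure.pi ν) := by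
  have hb : Integrable (fun x : Pairs N → ℝ => N * Real.log 2 + ∑ p, |x p|) (Measure.pi ν) :=
    (integrable_const _).add (integrable_finsetSum _ fun p _ => integrable_abs_coord ν hν p)
  refine hb.mono' ?_ (Eventually.of_forall fun x => ?_)
  · refine (continuous_logZ.measurable.comp ?_).aestronglyMeasurable
    exact measurable_pi_lambda _ fun p => (ht p).comp (measurable_pi_apply p)
  · have h1 := abs_logZ_sub_le fun p => t p (x p)
    have h2 : ∑ p, |t p (x p)| ≤ ∑ p, |x p| := Finset.sum_le_sum fun p _ => hle p _
    have h3 : 0 ≤ (N : ℝ) * Real.log 2 := by positivity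
    rw [Real.norm_eq_abs]
    have := abs_sub_abs_le_abs_sub (logZ fun p => t p (x p)) (N * Real.log 2)
    rw [abs_of_nonneg h3] at this
    linarith

lemma integrable_logZ {N : ℕ} (ν : Pairs N → Measure ℝ) [∀ p, IsProbabilityMeasure (ν p)]
    (hν : ∀ p, Integrable (fun y => y) (ν p)) : Integrable (logZ (N := N)) (Measure.pi ν) :=
  integrable_logZ_comp ν hν (fun _ y => y) (fun _ => measurable_id) fun _ _ => le_rfl

/-- The argument of the logarithm lies between `exp (-|y|)` and `exp |y|`. -/
lemma abs_log_cosh_add_le {m : ℝ} (hm : |m| ≤ 1) (y : ℝ) :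
    |Real.log (Real.cosh y + m * Real.sinh y)| ≤ |y| := by
  have hpos := cosh_add_mul_sinh_pos hm y
  have h1 := abs_le.1 hm
  have hs : |m * Real.sinh y| ≤ Real.sinh |y| := by
    rw [abs_mul, ← Real.abs_sinh]
    exact mul_le_of_le_one_left (abs_nonneg _) hm
  have hs := abs_le.1 hs
  rw [abs_le, Real.log_le_iff_le_exp hpos, Real.le_log_iff_exp_le hpos, ← Real.cosh_add_sinh |y|,
    ← Real.cosh_sub_sinh |y|, Real.cosh_abs]
  constructor <;> linarith

lemma measurable_gain : Measurable fun z : ℝ × ℝ => gain z.1 z.2 := by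
  have : Measurable Real.tanh := by
    have h : Real.tanh = fun y => Real.sinh y / Real.cosh y := funext Real.tanh_eq_sinh_div_cosh
    rw [h]
    exact Real.measurable_sinh.div Real.measurable_cosh
  unfold gain
  fun_prop

/-- Averaging over a symmetric coupling at one pair. -/
lemma integral_logZ_update_sub {N : ℕ} (ν : Measure ℝ) [IsProbabilityMeasure ν]
    (hsymm : MeasurePreserving (fun y : ℝ => -y) ν ν) (hν : Integrable (fun y => y) ν)
    (s : ℝ → ℝ) (hs : Measurable s) (hodd : ∀ y, s (-y) = -s y) (hle : ∀ y, |s y| ≤ |y|)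
    (z : Pairs N → ℝ) (e : Pairs N) :
    ∫ y, (logZ (Function.update z e (s y)) - logZ (Function.update z e 0)) ∂ν =
      ∫ y, gain (s y) (gibbs (Function.update z e 0) e.1.1 e.1.2) ∂ν := by
  set m := gibbs (Function.update z e 0) e.1.1 e.1.2 with hmdef
  have hm : |m| ≤ 1 := abs_gibbs_le_one _ _ _
  have hk : ∀ y, logZ (Function.update z e (s y)) - logZ (Function.update z e 0) =
      Real.log (Real.cosh (s y) + m * Real.sinh (s y)) := fun y => by
    rw [logZ_update z e (s y)]
    ring
  simp only [hk]
  set K : ℝ → ℝ := fun y => Real.log (Real.cosh (s y) + m * Real.sinh (s y)) with hK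
  have hKm : Measurable K := by
    have h1 := Real.measurable_cosh.comp hs
    have h2 := Real.measurable_sinh.comp hs
    exact Real.measurable_log.comp (h1.add (h2.const_mul m))
  have hKi : Integrable K ν := by
    refine hν.abs.mono' hKm.aestronglyMeasurable (Eventually.of_forall fun y => ?_)
    exact (abs_log_cosh_add_le hm _).trans (hle y)
  -- By symmetry of the law and oddness of `s`, the increment may be averaged with its reflection,
  -- which is the gain.
  have hneg : ∫ y, K (-y) ∂ν = ∫ y, K y ∂ν :=
    hsymm.integral_comp (MeasurableEquiv.neg ℝ).measurableEmbedding K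
  have hsum : ∀ y, K y + K (-y) = 2 * gain (s y) m := fun y => by
    simp only [hK, hodd]
    exact log_add_log_eq_gain hm (s y)
  have hKi' : Integrable (fun y => K (-y)) ν := hsymm.integrable_comp_of_integrable hKi
  have h2 : ∫ y, (K y + K (-y)) ∂ν = 2 * ∫ y, K y ∂ν := by
    rw [integral_add hKi hKi', hneg]
    ring
  simp only [hsum] at h2
  rw [integral_const_mul] at h2
  linarith

lemma integrable_gain {ν : Measure ℝ} (hν : Integrable (fun y => y) ν) {m : ℝ} (hm : |m| ≤ 1) :
    Integrable (fun y => gain y m) ν := by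
  refine hν.abs.mono' (measurable_gain.comp measurable_prodMk_right).aestronglyMeasurable
    (Eventually.of_forall fun y => ?_)
  rw [Real.norm_eq_abs, abs_of_nonneg (gain_nonneg hm y)]
  exact gain_le_abs hm y

/-! ### Removing small couplings -/

/-- `y` if `|y| ≥ δ`, and `0` otherwise. -/
def trunc (δ y : ℝ) : ℝ := if δ ≤ |y| then y else 0

lemma measurable_trunc (δ : ℝ) : Measurable (trunc δ) :=
  Measurable.ite (measurableSet_le measurable_const measurable_id.abs) measurable_id
    measurable_const

lemma abs_trunc_le (δ y : ℝ) : |trunc δ y| ≤ |y| := by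
  unfold trunc
  split_ifs <;> simp

lemma trunc_neg (δ y : ℝ) : trunc δ (-y) = -trunc δ y := by
  unfold trunc
  rw [abs_neg]
  split_ifs <;> simp

lemma abs_sub_trunc_le (δ y : ℝ) : |y - trunc δ y| ≤ |y| := by
  unfold trunc
  split_ifs <;> simp

/-- Removing the couplings below `δ` changes the average of `logZ` by at most half their total
variance. -/
lemma abs_integral_logZ_sub_trunc_le {N : ℕ} (ν : Measure ℝ) [IsProbabilityMeasure ν]
    (hsymm : MeasurePreserving (fun y : ℝ => -y) ν ν) (hν : Integrable (fun y => y) ν) (δ : ℝ) :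
    |∫ x, logZ x ∂(Measure.pi fun _ : Pairs N => ν) -
      ∫ x, logZ (fun p => trunc δ (x p)) ∂(Measure.pi fun _ : Pairs N => ν)| ≤
      Fintype.card (Pairs N) * ∫ y, (y - trunc δ y) ^ 2 / 2 ∂ν := by
  classical
  set κ := ∫ y, (y - trunc δ y) ^ 2 / 2 ∂ν with hκ
  have hsq : Integrable (fun y => (y - trunc δ y) ^ 2 / 2) ν := by
    refine (integrable_const (δ ^ 2 / 2)).mono'
      (((measurable_id.sub (measurable_trunc δ)).pow_const 2).div_const 2).aestronglyMeasurable
      (Eventually.of_forall fun y => ?_)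
    rw [Real.norm_eq_abs, abs_of_nonneg (by positivity)]
    unfold trunc
    split_ifs with h
    · simp; positivity
    · have := sq_lt_sq' (a := y) (b := δ) (by linarith [neg_abs_le y]) (by linarith [le_abs_self y])
      simp; linarith
  -- `τ A` truncates only the pairs in `A`. Enlarging `A` one pair at a time costs at most `κ` per
  -- pair.
  set τ : Finset (Pairs N) → (Pairs N → ℝ) → Pairs N → ℝ :=
    fun A x p => (fun y => if p ∈ A then trunc δ y else y) (x p) with hτ
  have hint : ∀ A, Integrable (fun x => logZ (τ A x)) (Measure.pi fun _ : Pairs N => ν) :=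
    fun A => by
      refine integrable_logZ_comp _ (fun _ => hν) (fun p y => if p ∈ A then trunc δ y else y)
        (fun p => ?_) fun p y => ?_
      · by_cases h : p ∈ A
        · simpa [h] using measurable_trunc δ
        · simpa only [h, if_false] using measurable_id'
      · by_cases h : p ∈ A
        · simpa [h] using abs_trunc_le δ y
        · simp [h]
  have key : ∀ A : Finset (Pairs N), |∫ x, logZ x ∂(Measure.pi fun _ : Pairs N => ν) -
      ∫ x, logZ (τ A x) ∂(Measure.pi fun _ : Pairs N => ν)| ≤ A.card * κ := by
    intro A
    induction A using Finset.induction_on with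
    | empty => simp [hτ]
    | insert e A he ih =>
      have hstep : |∫ x, logZ (τ A x) ∂(Measure.pi fun _ : Pairs N => ν) -
          ∫ x, logZ (τ (insert e A) x) ∂(Measure.pi fun _ : Pairs N => ν)| ≤ κ := by
        rw [← integral_sub (hint _) (hint _),
          integral_pi_eq_integral_update ν e
            (F := fun x => logZ (τ A x) - logZ (τ (insert e A) x)) ((hint _).sub (hint _))]
        have hinner : ∀ x : Pairs N → ℝ, ‖∫ y, (logZ (τ A (Function.update x e y)) -
            logZ (τ (insert e A) (Function.update x e y))) ∂ν‖ ≤ κ := fun x => by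
          have h1 : ∀ y, τ A (Function.update x e y) = Function.update (τ A x) e y := fun y => by
            ext p
            by_cases hp : p = e
            · subst hp; simp [hτ, he]
            · simp [hτ, hp]
          have h2 : ∀ y, τ (insert e A) (Function.update x e y) =
              Function.update (τ A x) e (trunc δ y) := fun y => by
            ext p
            by_cases hp : p = e
            · subst hp; simp [hτ]
            · simp [hτ, hp]
          -- Since `trunc δ y` is `y` or `0`, either both sides vanish or the removed coupling is
          -- `y` itself. The difference is thus the effect of the odd function `y - trunc δ y`.
          have h3 : ∀ y, logZ (τ A (Function.update x e y)) -
              logZ (τ (insert e A) (Function.update x e y)) =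
              logZ (Function.update (τ A x) e (y - trunc δ y)) -
                logZ (Function.update (τ A x) e 0) := fun y => by
            rw [h1, h2]
            by_cases h : δ ≤ |y| <;> simp [trunc, h]
          simp only [h3]
          rw [integral_logZ_update_sub ν hsymm hν (fun y => y - trunc δ y)
            (measurable_id.sub (measurable_trunc δ)) (fun y => by rw [trunc_neg]; ring)
            (abs_sub_trunc_le δ)]
          have hm := abs_gibbs_le_one (Function.update (τ A x) e 0) e.1.1 e.1.2
          rw [Real.norm_eq_abs, abs_of_nonneg (integral_nonneg fun y => gain_nonneg hm _)]
          exact integral_mono_of_nonneg (Eventually.of_forall fun y => gain_nonneg hm _) hsq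
            (Eventually.of_forall fun y => gain_le_half_sq hm _)
        have := norm_integral_le_of_norm_le_const (μ := Measure.pi fun _ : Pairs N => ν)
          (Eventually.of_forall hinner)
        simpa using this
      rw [Finset.card_insert_of_notMem he]
      push_cast
      have := abs_sub_le (∫ x, logZ x ∂(Measure.pi fun _ : Pairs N => ν))
        (∫ x, logZ (τ A x) ∂(Measure.pi fun _ : Pairs N => ν))
        (∫ x, logZ (τ (insert e A) x) ∂(Measure.pi fun _ : Pairs N => ν))
      linarith
  have := key Finset.univ
  simpa [hτ] using this

/-! ### Independent Bernoulli variables and Russo's formula -/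

/-- The probability of the outcome `b` of independent Bernoulli trials with parameters `p`. -/
def bernoulliWeight {ι : Type*} [Fintype ι] (p : ι → ℝ) (b : ι → Bool) : ℝ :=
  ∏ e, if b e then p e else 1 - p e

/-- The expectation of `g` over independent Bernoulli trials with parameters `p`. -/
def bernoulliMean {ι : Type*} [Fintype ι] [DecidableEq ι] (p : ι → ℝ) (g : (ι → Bool) → ℝ) : ℝ :=
  ∑ b, bernoulliWeight p b * g b

section Bernoulli

lemma bernoulliWeight_nonneg {ι : Type*} [Fintype ι]
    {p : ι → ℝ} (h0 : ∀ e, 0 ≤ p e) (h1 : ∀ e, p e ≤ 1)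
    (b : ι → Bool) : 0 ≤ bernoulliWeight p b := by
  refine Finset.prod_nonneg fun e _ => ?_
  split_ifs
  · exact h0 e
  · linarith [h1 e]

variable {ι : Type*} [Fintype ι] [DecidableEq ι]

/-- Flipping the bit `e` is an involution that preserves the bracket and exchanges the weights `a`
and `1 - a`. The freedom in `a` allows a missing Bernoulli factor to be restored. -/
lemma sum_bool_pi_eq (F : (ι → Bool) → ℝ) (e : ι) (a : ℝ) :
    ∑ b, F b = ∑ b : ι → Bool, (if b e then a else 1 - a) *
      (F (Function.update b e true) + F (Function.update b e false)) := by
  set φ : (ι → Bool) → (ι → Bool) := fun b => Function.update b e (!b e) with hφ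
  have hinv : Function.Involutive φ := fun b => by
    simp [hφ]
  set S : (ι → Bool) → ℝ :=
    fun b => F (Function.update b e true) + F (Function.update b e false) with hS
  have hSφ : ∀ b, S (φ b) = S b := fun b => by simp [hS, hφ]
  have hFS : ∀ b, F b + F (φ b) = S b := fun b => by
    cases hb : b e
    · have : Function.update b e false = b := by rw [← hb]; simp
      simp only [hS, hφ, hb, Bool.not_false, this]
      ring
    · have : Function.update b e true = b := by rw [← hb]; simp
      simp only [hS, hφ, hb, Bool.not_true, this]
  have h1 : ∑ b, F (φ b) = ∑ b, F b := Equiv.sum_comp hinv.toPerm F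
  have h2 : ∑ b, S b = 2 * ∑ b, F b := by
    rw [← Finset.sum_congr rfl fun b _ => hFS b, Finset.sum_add_distrib, h1]
    ring
  have h3 : ∑ b : ι → Bool, (if φ b e then a else 1 - a) * S (φ b) =
      ∑ b : ι → Bool, (if b e then a else 1 - a) * S b :=
    Equiv.sum_comp hinv.toPerm fun b : ι → Bool => (if b e then a else 1 - a) * S b
  have h4 : ∑ b : ι → Bool, (if φ b e then a else 1 - a) * S (φ b) +
      ∑ b : ι → Bool, (if b e then a else 1 - a) * S b = ∑ b, S b := by
    rw [← Finset.sum_add_distrib]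
    refine Finset.sum_congr rfl fun b _ => ?_
    rw [hSφ]
    cases hb : b e <;> simp [hφ, hb] <;> ring
  linarith

lemma sum_bernoulliWeight (p : ι → ℝ) : ∑ b, bernoulliWeight p b = 1 := by
  have h := Finset.prod_univ_sum (fun _ : ι => (Finset.univ : Finset Bool))
    fun e b => if b then p e else 1 - p e
  rw [Fintype.piFinset_univ] at h
  unfold bernoulliWeight
  rw [← h]
  simp

lemma bernoulliWeight_eq_mul (p : ι → ℝ) (b : ι → Bool) (e : ι) :
    bernoulliWeight p b = (if b e then p e else 1 - p e) *
      ∏ j ∈ Finset.univ.erase e, if b j then p j else 1 - p j :=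
  (Finset.mul_prod_erase _ _ (Finset.mem_univ e)).symm

lemma prod_erase_update (p : ι → ℝ) (b : ι → Bool) (e : ι) (a : Bool) :
    (∏ j ∈ Finset.univ.erase e, if Function.update b e a j then p j else 1 - p j) =
      ∏ j ∈ Finset.univ.erase e, if b j then p j else 1 - p j :=
  Finset.prod_congr rfl fun j hj => by rw [Function.update_of_ne (Finset.ne_of_mem_erase hj)]

lemma bernoulliMean_indicator (p : ι → ℝ) (e : ι) :
    bernoulliMean p (fun b => if b e then 1 else 0) = p e := by
  unfold bernoulliMean
  rw [sum_bool_pi_eq _ e (p e)]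
  have : ∀ b : ι → Bool, (if b e then p e else 1 - p e) *
      (bernoulliWeight p (Function.update b e true) *
          (if Function.update b e true e then 1 else 0) +
        bernoulliWeight p (Function.update b e false) *
          (if Function.update b e false e then 1 else 0)) = p e * bernoulliWeight p b := fun b => by
    rw [bernoulliWeight_eq_mul p b e, bernoulliWeight_eq_mul p (Function.update b e true) e,
      prod_erase_update]
    simp only [Function.update_self]
    simp
    ring_nf
  simp only [this]
  rw [← Finset.mul_sum, sum_bernoulliWeight, mul_one]

lemma bernoulliMean_mono {p : ι → ℝ} (h0 : ∀ e, 0 ≤ p e) (h1 : ∀ e, p e ≤ 1)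
    {g g' : (ι → Bool) → ℝ} (h : ∀ b, g b ≤ g' b) : bernoulliMean p g ≤ bernoulliMean p g' :=
  Finset.sum_le_sum fun b _ => mul_le_mul_of_nonneg_left (h b) (bernoulliWeight_nonneg h0 h1 b)

lemma bernoulliMean_const_mul (p : ι → ℝ) (a : ℝ) (g : (ι → Bool) → ℝ) :
    bernoulliMean p (fun b => a * g b) = a * bernoulliMean p g := by
  unfold bernoulliMean
  rw [Finset.mul_sum]
  exact Finset.sum_congr rfl fun b _ => by ring

lemma bernoulliMean_sub (p : ι → ℝ) (g g' : (ι → Bool) → ℝ) :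
    bernoulliMean p (fun b => g b - g' b) = bernoulliMean p g - bernoulliMean p g' := by
  unfold bernoulliMean
  rw [← Finset.sum_sub_distrib]
  exact Finset.sum_congr rfl fun b _ => by ring

lemma bernoulliMean_sum {κ : Type*} (s : Finset κ) (p : ι → ℝ) (g : κ → (ι → Bool) → ℝ) :
    bernoulliMean p (fun b => ∑ k ∈ s, g k b) = ∑ k ∈ s, bernoulliMean p (g k) := by
  unfold bernoulliMean
  rw [Finset.sum_comm]
  exact Finset.sum_congr rfl fun b _ => Finset.mul_sum _ _ _

/-- Russo's formula along a line in the space of parameters. -/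
lemma hasDerivAt_bernoulliMean (q v : ι → ℝ) (g : (ι → Bool) → ℝ) (t : ℝ) :
    HasDerivAt (fun t => bernoulliMean (fun e => q e + t * v e) g)
      (∑ e, v e * bernoulliMean (fun e => q e + t * v e)
        fun b => g (Function.update b e true) - g (Function.update b e false)) t := by
  set p : ι → ℝ := fun e => q e + t * v e with hp
  have hw : ∀ b : ι → Bool, HasDerivAt (fun t => bernoulliWeight (fun e => q e + t * v e) b)
      (∑ e, (∏ j ∈ Finset.univ.erase e, if b j then p j else 1 - p j) •
        (if b e then v e else -v e)) t := fun b => by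
    unfold bernoulliWeight
    refine HasDerivAt.fun_finsetProd
      (f := fun e t => if b e then q e + t * v e else 1 - (q e + t * v e)) fun e _ => ?_
    have h1 : HasDerivAt (fun t : ℝ => q e + t * v e) (v e) t := by
      simpa using ((hasDerivAt_id t).mul_const (v e)).const_add (q e)
    cases hb : b e
    · simpa using h1.const_sub 1
    · simpa using h1
  have hd : HasDerivAt (fun t => bernoulliMean (fun e => q e + t * v e) g)
      (∑ b : ι → Bool, (∑ e, (∏ j ∈ Finset.univ.erase e, if b j then p j else 1 - p j) •
        (if b e then v e else -v e)) * g b) t := by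
    unfold bernoulliMean
    exact HasDerivAt.fun_sum fun b _ => (hw b).mul_const (g b)
  convert hd using 1
  simp only [Finset.sum_mul]
  rw [Finset.sum_comm]
  refine Finset.sum_congr rfl fun e _ => ?_
  -- The derivative has lost the factor at `e`; taking `a = p e` puts it back and leaves the
  -- discrete difference of `g`.
  rw [sum_bool_pi_eq _ e (p e)]
  unfold bernoulliMean
  rw [Finset.mul_sum]
  refine Finset.sum_congr rfl fun b _ => ?_
  rw [prod_erase_update, prod_erase_update, bernoulliWeight_eq_mul _ b e]
  simp only [Function.update_self, smul_eq_mul]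
  simp
  ring_nf

end Bernoulli

/-! ### Diluted couplings -/

/-- The law equal to `μ` with probability `p` and to the point mass at `0` otherwise. -/
def mixture (p : ℝ) (μ : Measure ℝ) : Measure ℝ :=
  ENNReal.ofReal (1 - p) • Measure.dirac 0 + ENNReal.ofReal p • μ

lemma isProbabilityMeasure_mixture {p : ℝ} (h0 : 0 ≤ p) (h1 : p ≤ 1) (μ : Measure ℝ)
    [IsProbabilityMeasure μ] : IsProbabilityMeasure (mixture p μ) := by
  refine ⟨?_⟩
  simp only [mixture, Measure.add_apply, Measure.smul_apply, measure_univ, smul_eq_mul, mul_one]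
  rw [← ENNReal.ofReal_add (by linarith) h0]
  simp

lemma integrable_mixture (p : ℝ) {μ : Measure ℝ} (hμ : Integrable (fun y => y) μ) :
    Integrable (fun y => y) (mixture p μ) := by
  refine Integrable.add_measure (Integrable.smul_measure ?_ ENNReal.ofReal_ne_top)
    (hμ.smul_measure ENNReal.ofReal_ne_top)
  exact integrable_dirac (by simp)

/-- Set to `0` the coordinates of `x` not selected by `b`. -/
def mask {ι : Type*} (b : ι → Bool) (x : ι → ℝ) : ι → ℝ := fun e => if b e then x e else 0

lemma measurable_mask {ι : Type*} (b : ι → Bool) : Measurable (mask b) := by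
  refine measurable_pi_lambda _ fun e => ?_
  unfold mask
  cases b e
  · simp
  · simpa using measurable_pi_apply e

/-- Expanding the product of mixtures amounts to drawing the set of occupied coordinates first and
their values afterwards. It suffices to compare both sides on boxes. -/
lemma pi_mixture_eq_sum {ι : Type*} [Fintype ι] [DecidableEq ι] (p : ι → ℝ) (h0 : ∀ e, 0 ≤ p e)
    (h1 : ∀ e, p e ≤ 1) (μ : Measure ℝ) [IsProbabilityMeasure μ] :
    (Measure.pi fun e => mixture (p e) μ) = ∑ b : ι → Bool,
      ENNReal.ofReal (bernoulliWeight p b) • (Measure.pi fun _ : ι => μ).map (mask b) := by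
  have := fun e => isProbabilityMeasure_mixture (h0 e) (h1 e) μ
  refine Measure.pi_eq fun s hs => ?_
  rw [Measure.finsetSum_apply]
  have hb : ∀ b : ι → Bool, (ENNReal.ofReal (bernoulliWeight p b) •
      (Measure.pi fun _ : ι => μ).map (mask b)) (Set.univ.pi s) =
      ∏ e, if b e then ENNReal.ofReal (p e) * μ (s e)
        else ENNReal.ofReal (1 - p e) * Measure.dirac 0 (s e) := fun b => by
    have hpre : mask b ⁻¹' Set.univ.pi s =
        Set.univ.pi fun e => if b e then s e else {_y | (0 : ℝ) ∈ s e} := by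
      ext x
      simp only [Set.mem_preimage, Set.mem_pi, Set.mem_univ, true_imp_iff, mask]
      refine forall_congr' fun e => ?_
      cases b e <;> simp
    rw [Measure.smul_apply, Measure.map_apply (measurable_mask b) (MeasurableSet.univ_pi hs), hpre,
      Measure.pi_pi, smul_eq_mul, bernoulliWeight, ENNReal.ofReal_prod_of_nonneg,
      ← Finset.prod_mul_distrib]
    · refine Finset.prod_congr rfl fun e _ => ?_
      cases b e
      · by_cases h : (0 : ℝ) ∈ s e <;> simp [h, hs e]
      · simp
    · intro e _
      split_ifs
      · exact h0 e
      · linarith [h1 e]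
  simp only [hb]
  have h := Finset.prod_univ_sum (fun _ : ι => (Finset.univ : Finset Bool)) fun e b =>
    if b then ENNReal.ofReal (p e) * μ (s e)
      else ENNReal.ofReal (1 - p e) * Measure.dirac (0 : ℝ) (s e)
  rw [Fintype.piFinset_univ] at h
  rw [← h]
  refine Finset.prod_congr rfl fun e _ => ?_
  simp [mixture, add_comm]

/-- The average of `logZ` over the couplings on the pairs selected by `b`. -/
def maskedMean {N : ℕ} (μ : Measure ℝ) (b : Pairs N → Bool) : ℝ :=
  ∫ x, logZ (mask b x) ∂(Measure.pi fun _ : Pairs N => μ)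

lemma integrable_logZ_mask {N : ℕ} (μ : Measure ℝ) [IsProbabilityMeasure μ]
    (hμ : Integrable (fun y => y) μ) (b : Pairs N → Bool) :
    Integrable (fun x => logZ (mask b x)) (Measure.pi fun _ : Pairs N => μ) := by
  refine integrable_logZ_comp _ (fun _ => hμ) (fun e y => if b e then y else 0) (fun e => ?_)
    fun e y => ?_
  · cases b e
    · simp
    · simpa using measurable_id'
  · cases b e <;> simp

/-- This makes the average a polynomial in the occupation probabilities, to which Russo's formula
applies. -/
lemma integral_logZ_mixture {N : ℕ} (μ : Measure ℝ) [IsProbabilityMeasure μ]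
    (hμ : Integrable (fun y => y) μ) (p : Pairs N → ℝ) (h0 : ∀ e, 0 ≤ p e) (h1 : ∀ e, p e ≤ 1) :
    ∫ x, logZ x ∂(Measure.pi fun e => mixture (p e) μ) = bernoulliMean p (maskedMean μ) := by
  rw [pi_mixture_eq_sum p h0 h1, integral_finsetSum_measure]
  · refine Finset.sum_congr rfl fun b _ => ?_
    rw [integral_smul_measure, ENNReal.toReal_ofReal (bernoulliWeight_nonneg h0 h1 b),
      integral_map (measurable_mask b).aemeasurable continuous_logZ.aestronglyMeasurable]
    rfl
  · intro b _
    refine Integrable.smul_measure ?_ ENNReal.ofReal_ne_top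
    rw [integrable_map_measure continuous_logZ.aestronglyMeasurable
      (measurable_mask b).aemeasurable]
    exact integrable_logZ_mask μ hμ b

/-- The average gain from a coupling of law `μ`. -/
def meanGain (μ : Measure ℝ) (m : ℝ) : ℝ := ∫ y, gain y m ∂μ

lemma measurable_meanGain (μ : Measure ℝ) [SFinite μ] : Measurable (meanGain μ) :=
  (measurable_gain.stronglyMeasurable.integral_prod_left' (μ := μ)).measurable

lemma meanGain_nonneg (μ : Measure ℝ) {m : ℝ} (hm : |m| ≤ 1) : 0 ≤ meanGain μ m :=
  integral_nonneg fun y => gain_nonneg hm y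

lemma meanGain_le {μ : Measure ℝ} (hμ : Integrable (fun y => y) μ) {m : ℝ} (hm : |m| ≤ 1) :
    meanGain μ m ≤ ∫ y, |y| ∂μ :=
  integral_mono (integrable_gain hμ hm) hμ.abs fun y => gain_le_abs hm y

/-- The average gain at the pair `e` in the system with couplings on the pairs selected by `b`. -/
def pairGain {N : ℕ} (μ : Measure ℝ) (e : Pairs N) (b : Pairs N → Bool) : ℝ :=
  ∫ x, meanGain μ (gibbs (mask b x) e.1.1 e.1.2) ∂(Measure.pi fun _ : Pairs N => μ)

lemma integrable_meanGain_gibbs {N : ℕ} {μ : Measure ℝ} [IsProbabilityMeasure μ]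
    (hμ : Integrable (fun y => y) μ) (e : Pairs N) (b : Pairs N → Bool) :
    Integrable (fun x => meanGain μ (gibbs (mask b x) e.1.1 e.1.2))
      (Measure.pi fun _ : Pairs N => μ) := by
  refine (integrable_const (∫ y, |y| ∂μ)).mono' ?_ (Eventually.of_forall fun x => ?_)
  · exact ((measurable_meanGain μ).comp ((continuous_gibbs _ _).measurable.comp
      (measurable_mask b))).aestronglyMeasurable
  · have hm := abs_gibbs_le_one (mask b x) e.1.1 e.1.2
    rw [Real.norm_eq_abs, abs_of_nonneg (meanGain_nonneg μ hm)]
    exact meanGain_le hμ hm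

lemma pairGain_nonneg {N : ℕ} (μ : Measure ℝ) (e : Pairs N) (b : Pairs N → Bool) :
    0 ≤ pairGain μ e b :=
  integral_nonneg fun _ => meanGain_nonneg μ (abs_gibbs_le_one _ _ _)

lemma pairGain_le {N : ℕ} {μ : Measure ℝ} [IsProbabilityMeasure μ]
    (hμ : Integrable (fun y => y) μ) (e : Pairs N) (b : Pairs N → Bool) :
    pairGain μ e b ≤ ∫ y, |y| ∂μ := by
  have := integral_mono (integrable_meanGain_gibbs hμ e b) (integrable_const (∫ y, |y| ∂μ))
    fun x => meanGain_le hμ (abs_gibbs_le_one (mask b x) e.1.1 e.1.2)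
  simpa [pairGain] using this

/-- Identifies the discrete derivative in Russo's formula: integrating out the coupling at `e` with
the others frozen leaves the gain in the system where `e` is empty. -/
lemma maskedMean_update_sub {N : ℕ} {μ : Measure ℝ} [IsProbabilityMeasure μ]
    (hsymm : MeasurePreserving (fun y : ℝ => -y) μ μ) (hμ : Integrable (fun y => y) μ)
    (e : Pairs N) (b : Pairs N → Bool) :
    maskedMean μ (Function.update b e true) - maskedMean μ (Function.update b e false) =
      pairGain μ e (Function.update b e false) := by
  unfold maskedMean pairGain
  have hi := integrable_logZ_mask (N := N) μ hμ
  rw [← integral_sub (hi _) (hi _), integral_pi_eq_integral_update μ e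
    (F := fun x => logZ (mask (Function.update b e true) x) -
      logZ (mask (Function.update b e false) x)) ((hi _).sub (hi _))]
  refine integral_congr_ae (Eventually.of_forall fun x => ?_)
  have h1 : ∀ y, mask (Function.update b e true) (Function.update x e y) =
      Function.update (mask b x) e y := fun y => by
    ext p
    by_cases hp : p = e
    · subst hp; simp [mask]
    · simp [mask, hp]
  have h2 : ∀ y, mask (Function.update b e false) (Function.update x e y) =
      Function.update (mask b x) e 0 := fun y => by
    ext p
    by_cases hp : p = e
    · subst hp; simp [mask]
    · simp [mask, hp]
  have h3 : mask (Function.update b e false) x = Function.update (mask b x) e 0 := by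
    rw [← h2 (x e), Function.update_eq_self]
  simp only [h1, h2, h3]
  exact integral_logZ_update_sub μ hsymm hμ (fun y => y) measurable_id' (fun _ => rfl)
    (fun _ => le_rfl) (mask b x) e

/-- Removing the pair `e` itself affects the mean gain at `e` only if `e` is occupied. -/
lemma abs_bernoulliMean_pairGain_sub_le {N : ℕ} {μ : Measure ℝ} [IsProbabilityMeasure μ]
    (hμ : Integrable (fun y => y) μ) {p : Pairs N → ℝ} (h0 : ∀ e, 0 ≤ p e) (h1 : ∀ e, p e ≤ 1)
    (e : Pairs N) :
    |bernoulliMean p (fun b => pairGain μ e (Function.update b e false)) -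
      bernoulliMean p (pairGain μ e)| ≤ p e * ∫ y, |y| ∂μ := by
  rw [← bernoulliMean_sub]
  have hb : ∀ b : Pairs N → Bool, |pairGain μ e (Function.update b e false) - pairGain μ e b| ≤
      (∫ y, |y| ∂μ) * if b e then 1 else 0 := fun b => by
    cases hbe : b e
    · have : Function.update b e false = b := by rw [← hbe]; simp
      simp [this]
    · have h1 := pairGain_nonneg μ e b
      have h2 := pairGain_nonneg μ e (Function.update b e false)
      have h3 := pairGain_le hμ e b
      have h4 := pairGain_le hμ e (Function.update b e false)
      simp only [if_true, mul_one]
      rw [abs_le]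
      constructor <;> linarith
  have hu := bernoulliMean_mono h0 h1 fun b => (abs_le.1 (hb b)).2
  have hl := bernoulliMean_mono h0 h1 fun b => (abs_le.1 (hb b)).1
  have hval : bernoulliMean p (fun b => (∫ y, |y| ∂μ) * if b e then 1 else 0) =
      p e * ∫ y, |y| ∂μ := by
    rw [bernoulliMean_const_mul, bernoulliMean_indicator, mul_comm]
  have hneg : bernoulliMean p (fun b => -((∫ y, |y| ∂μ) * if b e then 1 else 0)) =
      -(p e * ∫ y, |y| ∂μ) := by
    rw [← hval, neg_eq_neg_one_mul, ← bernoulliMean_const_mul]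
    simp only [neg_one_mul]
  rw [hval] at hu
  rw [hneg] at hl
  exact abs_le.2 ⟨hl, hu⟩

/-- Interpolation between two dilution profiles `q` and `r`. -/
lemma bernoulliMean_maskedMean_le {N : ℕ} {μ : Measure ℝ} [IsProbabilityMeasure μ]
    (hsymm : MeasurePreserving (fun y : ℝ => -y) μ μ) (hμ : Integrable (fun y => y) μ)
    {q r : Pairs N → ℝ} (hq0 : ∀ e, 0 ≤ q e) (hq1 : ∀ e, q e ≤ 1) (hr0 : ∀ e, 0 ≤ r e)
    (hr1 : ∀ e, r e ≤ 1)
    (hpos : ∀ (x : Pairs N → ℝ) (y : ℝ),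
      0 ≤ ∑ e : Pairs N, (r e - q e) * gain y (gibbs x e.1.1 e.1.2)) :
    bernoulliMean q (maskedMean μ) ≤
      bernoulliMean r (maskedMean μ) + (∫ y, |y| ∂μ) * ∑ e, (r e ^ 2 + q e ^ 2) := by
  set κ := ∫ y, |y| ∂μ with hκ
  have hκ0 : 0 ≤ κ := integral_nonneg fun _ => abs_nonneg _
  set h : ℝ → ℝ := fun t => bernoulliMean (fun e => q e + t * (r e - q e)) (maskedMean μ) with hh
  have hd := fun t => hasDerivAt_bernoulliMean q (fun e => r e - q e) (maskedMean μ) t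
  -- The sign condition needs the same Gibbs measure at every pair, hence `b` rather than `b` with
  -- `e` emptied. The discrepancy is paid for in `hterm`.
  have hmean : ∀ b : Pairs N → Bool, 0 ≤ ∑ e, (r e - q e) * pairGain μ e b := fun b => by
    unfold pairGain
    simp only [← integral_const_mul]
    rw [← integral_finsetSum _ fun e _ => (integrable_meanGain_gibbs hμ e b).const_mul _]
    refine integral_nonneg fun x => ?_
    unfold meanGain
    simp only [← integral_const_mul]
    rw [Pi.zero_apply, ← integral_finsetSum _ fun e _ =>
      (integrable_gain hμ (abs_gibbs_le_one _ _ _)).const_mul _]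
    exact integral_nonneg fun y => hpos _ y
  have hderiv : ∀ t ∈ interior (Set.Icc (0 : ℝ) 1),
      -(κ * ∑ e, (r e ^ 2 + q e ^ 2)) ≤ deriv h t := by
    intro t ht
    rw [interior_Icc] at ht
    rw [(hd t).deriv]
    simp only [maskedMean_update_sub hsymm hμ]
    set p : Pairs N → ℝ := fun e => q e + t * (r e - q e) with hp
    have hp' : ∀ e, p e = (1 - t) * q e + t * r e := fun e => by rw [hp]; ring
    have ht0 := ht.1.le
    have ht1 : 0 ≤ 1 - t := by linarith [ht.2]
    have hp0 : ∀ e, 0 ≤ p e := fun e => by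
      rw [hp']
      exact add_nonneg (mul_nonneg ht1 (hq0 e)) (mul_nonneg ht0 (hr0 e))
    have hp1 : ∀ e, p e ≤ 1 := fun e => by
      rw [hp']
      nlinarith [hq1 e, hr1 e]
    have hsum : 0 ≤ ∑ e, (r e - q e) * bernoulliMean p (pairGain μ e) := by
      simp only [← bernoulliMean_const_mul]
      rw [← bernoulliMean_sum]
      exact Finset.sum_nonneg fun b _ =>
        mul_nonneg (bernoulliWeight_nonneg hp0 hp1 b) (hmean b)
    have hterm : ∀ e, (r e - q e) * bernoulliMean p (pairGain μ e) - κ * (r e ^ 2 + q e ^ 2) ≤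
        (r e - q e) * bernoulliMean p (fun b => pairGain μ e (Function.update b e false)) := by
      intro e
      have h1 := abs_bernoulliMean_pairGain_sub_le hμ hp0 hp1 e
      rw [← hκ] at h1
      set A := bernoulliMean p (fun b => pairGain μ e (Function.update b e false))
      set B := bernoulliMean p (pairGain μ e)
      have h2 : |(r e - q e) * (A - B)| ≤ |r e - q e| * (p e * κ) := by
        rw [abs_mul]
        exact mul_le_mul_of_nonneg_left h1 (abs_nonneg _)
      -- Both factors are at most `max (r e) (q e)`. The error is quadratic in the probabilities, so
      -- it stays bounded when they are of order `1 / N`.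
      have h3 : |r e - q e| * p e ≤ r e ^ 2 + q e ^ 2 := by
        have hm1 : |r e - q e| ≤ max (r e) (q e) := by
          rw [abs_le]
          have := le_max_left (r e) (q e)
          have := le_max_right (r e) (q e)
          have := hr0 e
          have := hq0 e
          constructor <;> linarith
        have hm2 : p e ≤ max (r e) (q e) := by
          rw [hp']
          nlinarith [le_max_left (r e) (q e), le_max_right (r e) (q e)]
        calc |r e - q e| * p e ≤ max (r e) (q e) * max (r e) (q e) :=
              mul_le_mul hm1 hm2 (hp0 e) ((abs_nonneg _).trans hm1)
          _ ≤ r e ^ 2 + q e ^ 2 := by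
              rcases max_cases (r e) (q e) with ⟨h, _⟩ | ⟨h, _⟩ <;> rw [h] <;>
                nlinarith [sq_nonneg (r e), sq_nonneg (q e)]
      have h4 := mul_le_mul_of_nonneg_left h3 hκ0
      have h5 := (abs_le.1 h2).1
      nlinarith
    have hle := Finset.sum_le_sum fun e (_ : e ∈ Finset.univ) => hterm e
    rw [Finset.sum_sub_distrib, ← Finset.mul_sum] at hle
    linarith
  have hdiff : Differentiable ℝ h := fun t => (hd t).differentiableAt
  have hmv := (convex_Icc (0 : ℝ) 1).mul_sub_le_image_sub_of_le_deriv hdiff.continuous.continuousOn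
    hdiff.differentiableOn hderiv 0 (by simp) 1 (by simp) zero_le_one
  have e0 : h 0 = bernoulliMean q (maskedMean μ) := by simp [hh]
  have e1 : h 1 = bernoulliMean r (maskedMean μ) := by simp [hh]
  rw [e0, e1] at hmv
  linarith

/-! ### Splitting the system into two blocks -/

/-- A pair of sites in the first block of `Fin (m + n)`. -/
def leftPair {m : ℕ} (n : ℕ) (p : Pairs m) : Pairs (m + n) :=
  ⟨(Fin.castAdd n p.1.1, Fin.castAdd n p.1.2), p.2⟩

/-- A pair of sites in the second block of `Fin (m + n)`. -/
def rightPair (m : ℕ) {n : ℕ} (p : Pairs n) : Pairs (m + n) :=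
  ⟨(Fin.natAdd m p.1.1, Fin.natAdd m p.1.2), Nat.add_lt_add_left p.2 m⟩

lemma leftPair_injective (m n : ℕ) : Function.Injective (leftPair n (m := m)) := fun p p' h => by
  have h' := congrArg Subtype.val h
  simp only [leftPair, Prod.mk.injEq, Fin.castAdd_inj] at h'
  exact Subtype.ext (Prod.ext h'.1 h'.2)

lemma rightPair_injective (m n : ℕ) : Function.Injective (rightPair m (n := n)) := fun p p' h => by
  have h' := congrArg Subtype.val h
  simp only [rightPair, Prod.mk.injEq, Fin.natAdd_inj] at h'
  exact Subtype.ext (Prod.ext h'.1 h'.2)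

lemma sum_pairs_eq_sum_dite {N : ℕ} (f : Pairs N → ℝ) :
    ∑ p, f p = ∑ i, ∑ j, if h : i < j then f ⟨(i, j), h⟩ else 0 := by
  rw [← Fintype.sum_prod_type' (f := fun i j => if h : i < j then f ⟨(i, j), h⟩ else 0)]
  have h := Finset.sum_subtype_of_mem (s := Finset.univ.filter fun p : Fin N × Fin N => p.1 < p.2)
    (p := fun p : Fin N × Fin N => p.1 < p.2)
    (f := fun p => if h : p.1 < p.2 then f ⟨(p.1, p.2), h⟩ else 0) (by simp)
  rw [Finset.sum_filter] at h
  have h1 : ∀ p : Fin N × Fin N, (if p.1 < p.2 then (if h : p.1 < p.2 then f ⟨(p.1, p.2), h⟩ else 0)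
      else 0) = if h : p.1 < p.2 then f ⟨(p.1, p.2), h⟩ else 0 := fun p => by
    split_ifs <;> rfl
  simp only [h1] at h
  rw [← h]
  refine Finset.sum_congr ?_ fun p _ => ?_
  · ext p
    simp [p.2]
  · rw [dif_pos p.2]

lemma sum_pairs_add {m n : ℕ} (f : Pairs (m + n) → ℝ)
    (hf : ∀ p : Pairs (m + n), (p.1.1 : ℕ) < m → m ≤ (p.1.2 : ℕ) → f p = 0) :
    ∑ p, f p = ∑ p : Pairs m, f (leftPair n p) + ∑ p : Pairs n, f (rightPair m p) := by
  simp only [sum_pairs_eq_sum_dite]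
  rw [Fin.sum_univ_add]
  congr 1
  · refine Finset.sum_congr rfl fun i _ => ?_
    rw [Fin.sum_univ_add]
    rw [Finset.sum_eq_zero (f := fun j : Fin n => _), add_zero]
    · refine Finset.sum_congr rfl fun j _ => ?_
      simp only [Fin.lt_def, Fin.val_castAdd, leftPair]
    · intro j _
      split_ifs with h
      · exact hf _ (by simp) (by simp)
      · rfl
  · refine Finset.sum_congr rfl fun i _ => ?_
    rw [Fin.sum_univ_add]
    rw [Finset.sum_eq_zero (f := fun j : Fin m => _), zero_add]
    · refine Finset.sum_congr rfl fun j _ => ?_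
      simp only [Fin.lt_def, Fin.val_natAdd, rightPair, add_lt_add_iff_left]
    · intro j _
      rw [dif_neg]
      simp only [Fin.lt_def, Fin.val_natAdd, Fin.val_castAdd]
      have := j.2
      omega

/-- Without couplings between the two blocks, `logZ` is additive. -/
lemma logZ_eq_add {m n : ℕ} (x : Pairs (m + n) → ℝ)
    (hx : ∀ p : Pairs (m + n), (p.1.1 : ℕ) < m → m ≤ (p.1.2 : ℕ) → x p = 0) :
    logZ x = logZ (fun p => x (leftPair n p)) + logZ (fun p => x (rightPair m p)) := by
  unfold logZ
  rw [← Real.log_mul (sum_exp_energy_pos _).ne' (sum_exp_energy_pos _).ne', Finset.sum_mul_sum,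
    ← Fintype.sum_prod_type' (f := fun σ τ => Real.exp (energy (fun p => x (leftPair n p)) σ) *
      Real.exp (energy (fun p => x (rightPair m p)) τ))]
  congr 1
  rw [← Equiv.sum_comp (Fin.appendEquiv m n)]
  refine Finset.sum_congr rfl fun στ _ => ?_
  rw [← Real.exp_add]
  congr 1
  unfold energy
  rw [sum_pairs_add _ fun p h1 h2 => by rw [hx p h1 h2, zero_mul]]
  simp [leftPair, rightPair, spin, Fin.appendEquiv]

lemma pi_map_comp {ι κ : Type*} [Fintype ι] [Fintype κ] (ν : ι → Measure ℝ)
    [∀ i, IsProbabilityMeasure (ν i)] (f : κ → ι) (hf : Function.Injective f) :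
    (Measure.pi ν).map (fun x k => x (f k)) = Measure.pi fun k => ν (f k) := by
  have h := (iIndepFun_pi (μ := ν) (X := fun _ y => y) fun _ => aemeasurable_id').precomp hf
  have h' := (iIndepFun_iff_map_fun_eq_pi_map
    (fun k => (measurable_pi_apply (f k)).aemeasurable)).1 h
  rw [h']
  congr 1
  ext1 k
  exact (measurePreserving_eval ν (f k)).map_eq

/-! ### The diluted model -/

/-- The average of `logZ` when each pair independently carries a coupling of law `μ` with
probability `c / N`. -/
def dilutedMean (μ : Measure ℝ) (c : ℝ) (N : ℕ) : ℝ :=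
  ∫ x, logZ x ∂(Measure.pi fun _ : Pairs N => mixture (c / N) μ)

lemma mixture_zero (μ : Measure ℝ) : mixture 0 μ = Measure.dirac 0 := by
  simp [mixture]

/-- The dilution profile with density `c / m` in the first block and `c / n` in the second. -/
def blockProfile (c : ℝ) (m n : ℕ) (e : Pairs (m + n)) : ℝ :=
  if (e.1.2 : ℕ) < m then c / m else if m ≤ (e.1.1 : ℕ) then c / n else 0

lemma blockProfile_left (c : ℝ) (m n : ℕ) (p : Pairs m) :
    blockProfile c m n (leftPair n p) = c / m := by
  simp [blockProfile, leftPair]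

lemma blockProfile_right (c : ℝ) (m n : ℕ) (p : Pairs n) :
    blockProfile c m n (rightPair m p) = c / n := by
  simp [blockProfile, rightPair]

lemma blockProfile_cross (c : ℝ) {m n : ℕ} (p : Pairs (m + n)) (h1 : (p.1.1 : ℕ) < m)
    (h2 : m ≤ (p.1.2 : ℕ)) : blockProfile c m n p = 0 := by
  rw [blockProfile, if_neg (by omega), if_neg (by omega)]

lemma blockProfile_nonneg {c : ℝ} (hc : 0 ≤ c) (m n : ℕ) (e : Pairs (m + n)) :
    0 ≤ blockProfile c m n e := by
  unfold blockProfile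
  split_ifs <;> positivity

lemma blockProfile_le_one {c : ℝ} {m n : ℕ} (hm : c ≤ m) (hn : c ≤ n) (e : Pairs (m + n)) :
    blockProfile c m n e ≤ 1 := by
  unfold blockProfile
  split_ifs
  · exact div_le_one_of_le₀ hm (Nat.cast_nonneg _)
  · exact div_le_one_of_le₀ hn (Nat.cast_nonneg _)
  · exact zero_le_one

/-- Cross couplings vanish almost surely, so `logZ` splits, and the marginal of each block is a
diluted model of that size. -/
lemma integral_logZ_blockProfile {μ : Measure ℝ} [IsProbabilityMeasure μ]
    (hμ : Integrable (fun y => y) μ) {c : ℝ} (hc : 0 ≤ c) {m n : ℕ} (hm : c ≤ m) (hn : c ≤ n) :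
    ∫ x, logZ x ∂(Measure.pi fun e => mixture (blockProfile c m n e) μ) =
      dilutedMean μ c m + dilutedMean μ c n := by
  set ν : Pairs (m + n) → Measure ℝ := fun e => mixture (blockProfile c m n e) μ with hν
  have hprob : ∀ e, IsProbabilityMeasure (ν e) := fun e =>
    isProbabilityMeasure_mixture (blockProfile_nonneg hc m n e) (blockProfile_le_one hm hn e) μ
  have hint : ∀ e, Integrable (fun y => y) (ν e) := fun e => integrable_mixture _ hμ
  have hae : ∀ᵐ x ∂(Measure.pi ν), ∀ p : Pairs (m + n),
      (p.1.1 : ℕ) < m → m ≤ (p.1.2 : ℕ) → x p = 0 := by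
    rw [ae_all_iff]
    intro p
    by_cases h : (p.1.1 : ℕ) < m ∧ m ≤ (p.1.2 : ℕ)
    · have h0 : ∀ᵐ y ∂(ν p), y = 0 := by
        simp only [hν]
        rw [blockProfile_cross c p h.1 h.2, mixture_zero]
        exact (ae_dirac_iff (measurableSet_singleton 0)).2 rfl
      filter_upwards [(measurePreserving_eval ν p).quasiMeasurePreserving.ae h0] with x hx _ _
      exact hx
    · exact Eventually.of_forall fun x h1 h2 => absurd ⟨h1, h2⟩ h
  rw [integral_congr_ae (hae.mono fun x hx => logZ_eq_add x hx)]
  have hl := pi_map_comp ν (leftPair n) (leftPair_injective m n)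
  have hr := pi_map_comp ν (rightPair m) (rightPair_injective m n)
  have hml : Measurable fun (x : Pairs (m + n) → ℝ) (k : Pairs m) => x (leftPair n k) :=
    measurable_pi_lambda _ fun k => measurable_pi_apply _
  have hmr : Measurable fun (x : Pairs (m + n) → ℝ) (k : Pairs n) => x (rightPair m k) :=
    measurable_pi_lambda _ fun k => measurable_pi_apply _
  have hil : Integrable (fun x : Pairs (m + n) → ℝ => logZ fun p => x (leftPair n p))
      (Measure.pi ν) := by
    have := integrable_logZ (fun p => ν (leftPair n p)) fun p => hint _
    rw [← hl, integrable_map_measure continuous_logZ.aestronglyMeasurable hml.aemeasurable] at this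
    exact this
  have hir : Integrable (fun x : Pairs (m + n) → ℝ => logZ fun p => x (rightPair m p))
      (Measure.pi ν) := by
    have := integrable_logZ (fun p => ν (rightPair m p)) fun p => hint _
    rw [← hr, integrable_map_measure continuous_logZ.aestronglyMeasurable hmr.aemeasurable] at this
    exact this
  rw [integral_add hil hir]
  congr 1
  · rw [← integral_map hml.aemeasurable continuous_logZ.aestronglyMeasurable, hl]
    simp only [hν, blockProfile_left]
    rfl
  · rw [← integral_map hmr.aemeasurable continuous_logZ.aestronglyMeasurable, hr]
    simp only [hν, blockProfile_right]
    rfl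

lemma card_pairs_le (N : ℕ) : (Fintype.card (Pairs N) : ℝ) ≤ (N : ℝ) ^ 2 := by
  have h := Fintype.card_subtype_le fun p : Fin N × Fin N => p.1 < p.2
  rw [Fintype.card_prod, Fintype.card_fin] at h
  rw [sq]
  exact_mod_cast h

lemma card_pairs_mul_sq_le (c : ℝ) (N : ℕ) :
    (Fintype.card (Pairs N) : ℝ) * (c / N) ^ 2 ≤ c ^ 2 := by
  rcases Nat.eq_zero_or_pos N with rfl | hN
  · simp; positivity
  · have hN' : (0 : ℝ) < N := by exact_mod_cast hN
    calc (Fintype.card (Pairs N) : ℝ) * (c / N) ^ 2 ≤ (N : ℝ) ^ 2 * (c / N) ^ 2 :=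
          mul_le_mul_of_nonneg_right (card_pairs_le N) (sq_nonneg _)
      _ = c ^ 2 := by field_simp

/-- The conditional negativity of the gain, applied to two blocks. -/
lemma sum_blockProfile_gain_nonneg {c : ℝ} (hc : 0 ≤ c) {m n : ℕ} (hm : 0 < m) (hn : 0 < n)
    (x : Pairs (m + n) → ℝ) (y : ℝ) :
    0 ≤ ∑ e : Pairs (m + n), (c / ((m + n : ℕ) : ℝ) - blockProfile c m n e) *
      gain y (gibbs x e.1.1 e.1.2) := by
  have hm' : (0 : ℝ) < m := by exact_mod_cast hm
  have hn' : (0 : ℝ) < n := by exact_mod_cast hn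
  -- `u` is the difference of the uniform distributions on the blocks, so it sums to zero; `K` is
  -- forced by the cross term `c / (m + n) = K / (m n)`.
  set u : Fin (m + n) → ℝ := fun i => if (i : ℕ) < m then 1 / m else -(1 / n) with hu
  set K : ℝ := c * m * n / (m + n) with hK
  have hu0 : ∑ i, u i = 0 := by
    rw [Fin.sum_univ_add]
    simp [hu, hm'.ne', hn'.ne']
  have hcoef : ∀ e : Pairs (m + n), c / ((m + n : ℕ) : ℝ) - blockProfile c m n e =
      -K * (u e.1.1 * u e.1.2) := fun e => by
    have hlt : (e.1.1 : ℕ) < e.1.2 := e.2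
    push_cast
    by_cases h2 : (e.1.2 : ℕ) < m
    · have h1 : (e.1.1 : ℕ) < m := by omega
      simp only [blockProfile, hu, hK, h1, h2, if_true]
      field_simp
      ring
    · by_cases h1 : (e.1.1 : ℕ) < m
      · simp only [blockProfile, hu, hK, h1, h2, if_true, if_false, not_le.2 h1]
        field_simp
        ring
      · simp only [blockProfile, hu, hK, h1, h2, if_true, if_false, not_lt.1 h1]
        field_simp
        ring
  have hsum := sum_pairs_eq_half_sum
    (fun i j => -K * (u i * u j) * gain y (gibbs x i j))
    (fun i j => by rw [gibbs_comm x i j, mul_comm (u i)])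
    (fun i => by rw [gibbs_self, gain_one, mul_zero])
  simp only [hcoef]
  rw [hsum]
  have h0 := sum_mul_gain_nonpos x u hu0 y
  have h1 : ∑ i, ∑ j, -K * (u i * u j) * gain y (gibbs x i j) =
      -K * ∑ i, ∑ j, u i * u j * gain y (gibbs x i j) := by
    simp only [Finset.mul_sum, mul_assoc]
  have hK0 : 0 ≤ K := by positivity
  rw [h1]
  nlinarith

/-- The averaged log-partition function of the diluted model is superadditive up to a constant. -/
lemma dilutedMean_add_le {μ : Measure ℝ} [IsProbabilityMeasure μ]
    (hsymm : MeasurePreserving (fun y : ℝ => -y) μ μ) (hμ : Integrable (fun y => y) μ)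
    {c : ℝ} (hc : 0 ≤ c) {m n : ℕ} (hm0 : 0 < m) (hn0 : 0 < n) (hm : c ≤ m) (hn : c ≤ n) :
    dilutedMean μ c m + dilutedMean μ c n ≤
      dilutedMean μ c (m + n) + (∫ y, |y| ∂μ) * (3 * c ^ 2) := by
  have hr0 : 0 ≤ c / ((m + n : ℕ) : ℝ) := by positivity
  have hr1 : c / ((m + n : ℕ) : ℝ) ≤ 1 := by
    refine div_le_one_of_le₀ ?_ (Nat.cast_nonneg _)
    push_cast
    linarith [(Nat.cast_nonneg n : (0 : ℝ) ≤ n)]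
  have h := bernoulliMean_maskedMean_le hsymm hμ (blockProfile_nonneg hc m n)
    (blockProfile_le_one hm hn) (r := fun _ => c / ((m + n : ℕ) : ℝ)) (fun _ => hr0)
    (fun _ => hr1) (sum_blockProfile_gain_nonneg hc hm0 hn0)
  rw [← integral_logZ_mixture μ hμ _ (blockProfile_nonneg hc m n) (blockProfile_le_one hm hn),
    ← integral_logZ_mixture μ hμ _ (fun _ => hr0) (fun _ => hr1),
    integral_logZ_blockProfile hμ hc hm hn] at h
  refine h.trans (add_le_add le_rfl (mul_le_mul_of_nonneg_left ?_
    (integral_nonneg fun _ => abs_nonneg _)))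
  rw [Finset.sum_add_distrib, sum_pairs_add (fun e => blockProfile c m n e ^ 2)
    fun p h1 h2 => by simp [blockProfile_cross c p h1 h2]]
  simp only [blockProfile_left, blockProfile_right, Finset.sum_const, Finset.card_univ,
    nsmul_eq_mul]
  -- The whole system and the two blocks each contribute at most `c ^ 2`, whence the constant `3 * c
  -- ^ 2`.
  have h1 := card_pairs_mul_sq_le c (m + n)
  have h2 := card_pairs_mul_sq_le c m
  have h3 := card_pairs_mul_sq_le c n
  linarith

lemma integral_abs_mixture {p : ℝ} (hp : 0 ≤ p) {μ : Measure ℝ} (hμ : Integrable (fun y => y) μ) :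
    ∫ y, |y| ∂(mixture p μ) = p * ∫ y, |y| ∂μ := by
  unfold mixture
  rw [integral_add_measure, integral_smul_measure, integral_smul_measure, integral_dirac,
    ENNReal.toReal_ofReal hp]
  · simp
  · exact Integrable.smul_measure (integrable_dirac (by simp)) ENNReal.ofReal_ne_top
  · exact hμ.abs.smul_measure ENNReal.ofReal_ne_top

lemma dilutedMean_le {μ : Measure ℝ} [IsProbabilityMeasure μ] (hμ : Integrable (fun y => y) μ)
    {c : ℝ} (hc : 0 ≤ c) {N : ℕ} (hN0 : 0 < N) (hN : c ≤ N) :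
    dilutedMean μ c N ≤ (Real.log 2 + c * ∫ y, |y| ∂μ) * N := by
  have hN' : (0 : ℝ) < N := by exact_mod_cast hN0
  have hp0 : 0 ≤ c / N := by positivity
  have := isProbabilityMeasure_mixture hp0 ((div_le_one hN').2 hN) μ
  have hi := integrable_mixture (c / N) hμ
  have hcoord := fun p : Pairs N => integrable_abs_coord (fun _ => mixture (c / N) μ)
    (fun _ => hi) p
  have h1 : dilutedMean μ c N ≤ ∫ x, (N * Real.log 2 + ∑ p, |x p|)
      ∂(Measure.pi fun _ : Pairs N => mixture (c / N) μ) := by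
    refine integral_mono (integrable_logZ _ fun _ => hi)
      ((integrable_const _).add (integrable_finsetSum _ fun p _ => hcoord p)) fun x => ?_
    have := (abs_le.1 (abs_logZ_sub_le x)).2
    simp only
    linarith
  have h2 : ∀ p : Pairs N, ∫ x, |x p| ∂(Measure.pi fun _ : Pairs N => mixture (c / N) μ) =
      c / N * ∫ y, |y| ∂μ := fun p => by
    rw [← integral_abs_mixture hp0 hμ]
    exact integral_comp_eval (X := fun _ : Pairs N => ℝ) (μ := fun _ => mixture (c / N) μ)
      (i := p) (f := fun y : ℝ => |y|) hi.abs.aestronglyMeasurable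
  rw [integral_add (integrable_const _) (integrable_finsetSum _ fun p _ => hcoord p),
    integral_finsetSum _ fun p _ => hcoord p, integral_const, probReal_univ, one_smul] at h1
  simp only [h2, Finset.sum_const, Finset.card_univ, nsmul_eq_mul] at h1
  have h3 : (Fintype.card (Pairs N) : ℝ) * (c / N * ∫ y, |y| ∂μ) ≤
      (N : ℝ) ^ 2 * (c / N * ∫ y, |y| ∂μ) :=
    mul_le_mul_of_nonneg_right (card_pairs_le N)
      (mul_nonneg hp0 (integral_nonneg fun _ => abs_nonneg _))
  have h4 : (N : ℝ) ^ 2 * (c / N * ∫ y, |y| ∂μ) = c * (∫ y, |y| ∂μ) * N := by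
    field_simp
  linarith

/-! ### Fekete's lemma for almost superadditive sequences -/

/-- Subtracting `C` makes the sequence truly superadditive beyond `n₀`, and the limit is then the
supremum of `g n / n` over `n ≥ n₀`. -/
lemma exists_tendsto_div_of_superadditive {f : ℕ → ℝ} {C B : ℝ} {n₀ : ℕ} (hn₀ : 0 < n₀)
    (hsup : ∀ m n, n₀ ≤ m → n₀ ≤ n → f m + f n ≤ f (m + n) + C)
    (hB : ∀ n, n₀ ≤ n → f n ≤ B * n) :
    ∃ L, Tendsto (fun n : ℕ => f n / n) atTop (𝓝 L) := by
  set g : ℕ → ℝ := fun n => f n - C with hg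
  have hgsup : ∀ m n, n₀ ≤ m → n₀ ≤ n → g m + g n ≤ g (m + n) := fun m n hm hn => by
    have := hsup m n hm hn
    simp only [hg]
    linarith
  have hlow : ∀ m, n₀ ≤ m → ∃ M : ℝ, ∀ N, m ≤ N → N * (g m / m) - M ≤ g N := by
    intro m hm
    have hm0 : (0 : ℝ) < m := by exact_mod_cast hn₀.trans_le hm
    set a := g m / m with ha
    have ham : m * a = g m := by rw [ha]; field_simp
    -- Steps of size `m` are removed only while `N ≥ 2 * m`, so the remainder stays at least `m ≥
    -- n₀`, where superadditivity holds. The sum bounds the defect at every possible starting value.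
    refine ⟨∑ s ∈ Finset.range (2 * m), |g s - s * a|, fun N => ?_⟩
    induction N using Nat.strong_induction_on with
    | _ N ih =>
      intro hN
      rcases lt_or_ge N (2 * m) with h | h
      · have h1 := Finset.single_le_sum (f := fun s : ℕ => |g s - s * a|)
          (fun s _ => abs_nonneg _) (Finset.mem_range.2 h)
        have h2 := neg_abs_le (g N - N * a)
        linarith
      · have h1 := ih (N - m) (by omega) (by omega)
        have h2 := hgsup (N - m) m (by omega) hm
        rw [Nat.sub_add_cancel hN] at h2
        rw [Nat.cast_sub hN] at h1
        linarith
  set S : Set ℝ := (fun n : ℕ => g n / n) '' Set.Ici n₀ with hS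
  have hbdd : BddAbove S := by
    refine ⟨B + |C|, ?_⟩
    rintro _ ⟨n, hn, rfl⟩
    have hn1 : (1 : ℝ) ≤ n := by exact_mod_cast hn₀.trans_le hn
    have := hB n hn
    simp only [hg]
    rw [div_le_iff₀ (by linarith)]
    have h3 : |C| ≤ |C| * n := le_mul_of_one_le_right (abs_nonneg _) hn1
    have h4 := neg_abs_le C
    linarith
  have hg_lim : Tendsto (fun n : ℕ => g n / n) atTop (𝓝 (sSup S)) := by
    rw [tendsto_order]
    constructor
    · intro a ha
      have hne : S.Nonempty := ⟨_, n₀, Set.self_mem_Ici, rfl⟩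
      obtain ⟨_, ⟨m, hm, rfl⟩, hma⟩ := exists_lt_of_lt_csSup hne ha
      obtain ⟨M, hM⟩ := hlow m hm
      have ht : Tendsto (fun N : ℕ => g m / m - M / N) atTop (𝓝 (g m / m - 0)) :=
        tendsto_const_nhds.sub (tendsto_const_div_atTop_nhds_zero_nat M)
      rw [sub_zero] at ht
      filter_upwards [ht.eventually_const_lt hma, eventually_ge_atTop m,
        eventually_gt_atTop 0] with N h1 h2 h3
      have hN : (0 : ℝ) < N := by exact_mod_cast h3
      refine h1.trans_le ?_
      rw [le_div_iff₀ hN, sub_mul, div_mul_cancel₀ _ hN.ne']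
      linarith [hM N h2]
    · intro a ha
      filter_upwards [eventually_ge_atTop n₀] with N hN
      exact (le_csSup hbdd ⟨N, hN, rfl⟩).trans_lt ha
  refine ⟨sSup S, ?_⟩
  have := hg_lim.add (tendsto_const_div_atTop_nhds_zero_nat C)
  rw [add_zero] at this
  refine this.congr fun n => ?_
  simp only [hg]
  ring

/-- The diluted model has a limiting free energy. -/
lemma exists_tendsto_dilutedMean {μ : Measure ℝ} [IsProbabilityMeasure μ]
    (hsymm : MeasurePreserving (fun y : ℝ => -y) μ μ) (hμ : Integrable (fun y => y) μ)
    {c : ℝ} (hc : 0 ≤ c) : ∃ L, Tendsto (fun N : ℕ => dilutedMean μ c N / N) atTop (𝓝 L) := by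
  obtain ⟨k, hk⟩ := exists_nat_ge c
  -- Sizes from `k + 1` on are positive and make `c / n` a probability.
  have hle : ∀ n : ℕ, k + 1 ≤ n → c ≤ n := fun n hn => by
    have : ((k + 1 : ℕ) : ℝ) ≤ n := by exact_mod_cast hn
    push_cast at this
    linarith
  exact exists_tendsto_div_of_superadditive (Nat.succ_pos k)
    (fun m n hm hn => dilutedMean_add_le hsymm hμ hc (by omega) (by omega) (hle m hm) (hle n hn))
    fun n hn => dilutedMean_le hμ hc (by omega) (hle n hn)

/-! ### Laws with power tails -/

lemma measurableSet_le_abs (t : ℝ) : MeasurableSet {y : ℝ | t ≤ |y|} :=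
  measurableSet_le measurable_const measurable_id.abs

/-- Layer-cake formula: the tail is at most `1` on `(0, 1]`, and `t ^ (-α)` is integrable at
infinity because `α > 1`. -/
lemma integrable_of_tail {ρ : Measure ℝ} [IsProbabilityMeasure ρ] {α C : ℝ} (hα : 1 < α)
    (htail : ∀ t : ℝ, 1 < t → ρ.real {y | t ≤ |y|} = C / t ^ α) :
    Integrable (fun y => y) ρ := by
  rw [← integrable_norm_iff measurable_id'.aestronglyMeasurable]
  refine ⟨measurable_id'.norm.aestronglyMeasurable, ?_⟩
  rw [hasFiniteIntegral_iff_ofReal (Eventually.of_forall fun _ => norm_nonneg _)]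
  simp only [Real.norm_eq_abs]
  rw [lintegral_eq_lintegral_meas_le ρ (Eventually.of_forall fun y => abs_nonneg y)
    measurable_id'.abs.aemeasurable, ← Set.Ioc_union_Ioi_eq_Ioi (zero_le_one' ℝ)]
  refine (lintegral_union_le _ _ _).trans_lt (ENNReal.add_lt_top.2 ⟨?_, ?_⟩)
  · calc ∫⁻ t in Set.Ioc (0 : ℝ) 1, ρ {y | t ≤ |y|} ≤ ∫⁻ _t in Set.Ioc (0 : ℝ) 1, 1 :=
          lintegral_mono fun t => prob_le_one
      _ < ⊤ := by simp
  · have h1 : ∫⁻ t in Set.Ioi (1 : ℝ), ρ {y | t ≤ |y|} =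
        ∫⁻ t in Set.Ioi (1 : ℝ), ENNReal.ofReal (C * t ^ (-α)) := by
      refine setLIntegral_congr_fun measurableSet_Ioi fun t ht => ?_
      have ht' : (0 : ℝ) < t := zero_lt_one.trans ht
      rw [Real.rpow_neg ht'.le, ← div_eq_mul_inv, ← htail t ht, ofReal_measureReal]
    rw [h1]
    have hi := (integrableOn_Ioi_rpow_of_lt (a := -α) (by linarith) zero_lt_one).const_mul C
    exact hi.lintegral_lt_top

/-- A global bound for the tail. -/
lemma tail_le {ρ : Measure ℝ} [IsProbabilityMeasure ρ] {α C : ℝ} (hα : 0 < α) (hC : 0 < C)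
    (htail : ∀ t : ℝ, 1 < t → ρ.real {y | t ≤ |y|} = C / t ^ α) (t : ℝ) (ht : 0 < t) :
    ρ.real {y | t ≤ |y|} ≤ (1 + C) * t ^ (-α) := by
  have hpos := Real.rpow_pos_of_pos ht (-α)
  rcases lt_or_ge 1 t with h | h
  · rw [htail t h, Real.rpow_neg ht.le, ← div_eq_mul_inv]
    gcongr
    linarith
  · have h1 := Real.one_le_rpow_of_pos_of_le_one_of_nonpos ht h (neg_nonpos.2 hα.le)
    have h2 : ρ.real {y | t ≤ |y|} ≤ 1 := measureReal_le_one
    nlinarith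

/-- The truncated second moment of a law with tails of order `α < 2`. -/
lemma integral_sub_trunc_sq_le {ν : Measure ℝ} [IsProbabilityMeasure ν] {α D : ℝ}
    (hα' : α < 2) (htail : ∀ t : ℝ, 0 < t → ν.real {y | t ≤ |y|} ≤ D * t ^ (-α)) {δ : ℝ}
    (hδ : 0 < δ) :
    ∫ y, (y - trunc δ y) ^ 2 ∂ν ≤ D * (δ ^ (2 - α) / (1 - α / 2)) := by
  have hle : ∀ y, (y - trunc δ y) ^ 2 ≤ δ ^ 2 := fun y => by
    unfold trunc
    split_ifs with h
    · simp; positivity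
    · rw [sub_zero, ← sq_abs]
      exact pow_le_pow_left₀ (abs_nonneg y) (not_le.1 h).le 2
  have hint : Integrable (fun y => (y - trunc δ y) ^ 2) ν := by
    refine (integrable_const (δ ^ 2)).mono'
      ((measurable_id.sub (measurable_trunc δ)).pow_const 2).aestronglyMeasurable
      (Eventually.of_forall fun y => ?_)
    rw [Real.norm_eq_abs, abs_of_nonneg (sq_nonneg _)]
    exact hle y
  rw [hint.integral_eq_integral_Ioc_meas_le (M := δ ^ 2)
    (Eventually.of_forall fun _ => sq_nonneg _) (Eventually.of_forall hle)]
  have hbound : ∀ t ∈ Set.Ioc 0 (δ ^ 2), ν.real {y | t ≤ (y - trunc δ y) ^ 2} ≤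
      D * t ^ (-(α / 2)) := fun t ht => by
    have hsub : {y : ℝ | t ≤ (y - trunc δ y) ^ 2} ⊆ {y | √t ≤ |y|} := fun y hy => by
      have h1 := Real.sqrt_le_sqrt (show t ≤ (y - trunc δ y) ^ 2 from hy)
      rw [Real.sqrt_sq_eq_abs] at h1
      exact h1.trans (abs_sub_trunc_le δ y)
    refine (measureReal_mono hsub).trans ((htail _ (Real.sqrt_pos.2 ht.1)).trans_eq ?_)
    rw [Real.sqrt_eq_rpow, ← Real.rpow_mul ht.1.le]
    ring_nf
  have hii : IntegrableOn (fun t : ℝ => D * t ^ (-(α / 2))) (Set.Ioc 0 (δ ^ 2)) := by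
    rw [← intervalIntegrable_iff_integrableOn_Ioc_of_le (sq_nonneg δ)]
    exact (intervalIntegral.intervalIntegrable_rpow' (by linarith)).const_mul D
  have hmono : ∫ t in Set.Ioc 0 (δ ^ 2), ν.real {y | t ≤ (y - trunc δ y) ^ 2} ≤
      ∫ t in Set.Ioc 0 (δ ^ 2), D * t ^ (-(α / 2)) := by
    refine integral_mono_of_nonneg (Eventually.of_forall fun _ => measureReal_nonneg) hii ?_
    exact (ae_restrict_iff' measurableSet_Ioc).2 (Eventually.of_forall hbound)
  refine hmono.trans_eq ?_
  rw [← intervalIntegral.integral_of_le (sq_nonneg δ), intervalIntegral.integral_const_mul,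
    integral_rpow (Or.inl (by linarith)), Real.zero_rpow (by linarith), sub_zero,
    ← Real.rpow_natCast δ 2, ← Real.rpow_mul hδ.le]
  congr 2
  · congr 1
    push_cast
    ring
  · ring

/-- A symmetric finite measure is determined away from the origin by its two-sided tails. -/
lemma restrict_eq_of_tail_eq {κ κ' : Measure ℝ} [IsFiniteMeasure κ] [IsFiniteMeasure κ']
    (hκ : MeasurePreserving (fun y : ℝ => -y) κ κ)
    (hκ' : MeasurePreserving (fun y : ℝ => -y) κ' κ')
    {δ : ℝ} (hδ : 0 < δ)
    (h : ∀ t, δ ≤ t → κ.real {y | t ≤ |y|} = κ'.real {y | t ≤ |y|}) :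
    κ.restrict {y | δ ≤ |y|} = κ'.restrict {y | δ ≤ |y|} := by
  have hset : ∀ t : ℝ, {y : ℝ | t ≤ |y|} = Set.Ici t ∪ Set.Iic (-t) := fun t => by
    ext y
    simp only [Set.mem_ofPred_eq, Set.mem_union, Set.mem_Ici, Set.mem_Iic, le_abs, le_neg]
  have hdisj : ∀ t : ℝ, 0 < t → Disjoint (Set.Ici t) (Set.Iic (-t)) := fun t ht =>
    Set.disjoint_left.2 fun y h1 h2 => by
      simp only [Set.mem_Ici, Set.mem_Iic] at h1 h2
      linarith
  have hpre : ∀ t : ℝ, (fun y : ℝ => -y) ⁻¹' Set.Ici t = Set.Iic (-t) := fun t => by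
    ext y
    simp
  have hpre' : ∀ t : ℝ, (fun y : ℝ => -y) ⁻¹' Set.Iic (-t) = Set.Ici t := fun t => by
    ext y
    simp
  -- Symmetry turns two-sided tails into one-sided ones, and the half-lines `Ici t` determine the
  -- positive part of a measure. Reflection then gives the negative part.
  have hhalf : ∀ (η : Measure ℝ) [IsFiniteMeasure η], MeasurePreserving (fun y : ℝ => -y) η η →
      ∀ t : ℝ, 0 < t → η.real {y | t ≤ |y|} = 2 * η.real (Set.Ici t) := fun η _ hη t ht => by
    have h1 := hη.measureReal_preimage (measurableSet_Ici (a := t)).nullMeasurableSet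
    rw [hpre] at h1
    rw [hset, measureReal_union (hdisj t ht) measurableSet_Iic, h1]
    ring
  have hright : κ.restrict (Set.Ici δ) = κ'.restrict (Set.Ici δ) := by
    refine Measure.ext_of_Ici _ _ fun t => ?_
    rw [Measure.restrict_apply measurableSet_Ici, Measure.restrict_apply measurableSet_Ici,
      Set.Ici_inter_Ici]
    have hmax : δ ≤ t ⊔ δ := le_max_right _ _
    have h1 := h _ hmax
    rw [hhalf κ hκ _ (hδ.trans_le hmax), hhalf κ' hκ' _ (hδ.trans_le hmax)] at h1
    rw [← measureReal_eq_measureReal_iff]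
    linarith
  have hleft : κ.restrict (Set.Iic (-δ)) = κ'.restrict (Set.Iic (-δ)) := by
    have h1 := (hκ.restrict_preimage (measurableSet_Iic (a := -δ))).map_eq
    have h2 := (hκ'.restrict_preimage (measurableSet_Iic (a := -δ))).map_eq
    rw [hpre'] at h1 h2
    rw [← h1, ← h2, hright]
  rw [hset, Measure.restrict_union (hdisj δ hδ) measurableSet_Iic,
    Measure.restrict_union (hdisj δ hδ) measurableSet_Iic, hright, hleft]

lemma map_trunc_eq {ν : Measure ℝ} [IsProbabilityMeasure ν] (δ : ℝ) :
    ν.map (trunc δ) = ν {y | δ ≤ |y|}ᶜ • Measure.dirac 0 + ν.restrict {y | δ ≤ |y|} := by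
  have hA := measurableSet_le_abs δ
  conv_lhs => rw [← Measure.restrict_add_restrict_compl (μ := ν) hA]
  rw [Measure.map_add _ _ (measurable_trunc δ), add_comm]
  congr 1
  · have h : trunc δ =ᵐ[ν.restrict {y | δ ≤ |y|}ᶜ] fun _ => 0 :=
      (ae_restrict_iff' hA.compl).2 (Eventually.of_forall fun y hy => if_neg hy)
    rw [Measure.map_congr h, Measure.map_const, Measure.restrict_apply_univ]
  · have h : trunc δ =ᵐ[ν.restrict {y | δ ≤ |y|}] id :=
      (ae_restrict_iff' hA).2 (Eventually.of_forall fun y hy => if_pos hy)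
    rw [Measure.map_congr h, Measure.map_id]

/-! ### The scaled couplings -/

/-- The law of `β N^{-1/α} J` for `J` of law `ρ`. -/
def scaledLaw (ρ : Measure ℝ) (α β : ℝ) (N : ℕ) : Measure ℝ :=
  ρ.map fun y => β / (N : ℝ) ^ (1 / α) * y

section Scaled

variable {ρ : Measure ℝ} (α β : ℝ) (N : ℕ)

instance isProbabilityMeasure_scaledLaw [IsProbabilityMeasure ρ] :
    IsProbabilityMeasure (scaledLaw ρ α β N) :=
  Measure.isProbabilityMeasure_map (measurable_const_mul _).aemeasurable

lemma integrable_scaledLaw (hρ : Integrable (fun y => y) ρ) :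
    Integrable (fun y => y) (scaledLaw ρ α β N) := by
  unfold scaledLaw
  rw [integrable_map_measure measurable_id'.aestronglyMeasurable
    (measurable_const_mul _).aemeasurable]
  exact hρ.const_mul _

lemma measurePreserving_neg_scaledLaw (hρ : MeasurePreserving (fun y : ℝ => -y) ρ ρ) :
    MeasurePreserving (fun y : ℝ => -y) (scaledLaw ρ α β N) (scaledLaw ρ α β N) := by
  refine ⟨measurable_neg, ?_⟩
  unfold scaledLaw
  conv_rhs => rw [← hρ.map_eq]
  rw [Measure.map_map measurable_neg (measurable_const_mul _),
    Measure.map_map (measurable_const_mul _) measurable_neg]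
  congr 1
  ext y
  simp

variable {α β N}

lemma scaledLaw_tail (hβ : 0 < β) (hN : 0 < N) (t : ℝ) :
    (scaledLaw ρ α β N).real {y | t ≤ |y|} =
      ρ.real {y | t / (β / (N : ℝ) ^ (1 / α)) ≤ |y|} := by
  have ha : 0 < β / (N : ℝ) ^ (1 / α) := by positivity
  unfold scaledLaw
  rw [map_measureReal_apply (measurable_const_mul _) (measurableSet_le_abs t)]
  congr 1
  ext y
  simp only [Set.mem_preimage, Set.mem_ofPred_eq]
  rw [abs_mul, abs_of_pos ha, div_le_iff₀ ha, mul_comm]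

lemma scale_rpow (hα : 0 < α) (hβ : 0 < β) :
    (β / (N : ℝ) ^ (1 / α)) ^ α = β ^ α / N := by
  rw [Real.div_rpow hβ.le (by positivity), ← Real.rpow_mul (Nat.cast_nonneg N),
    one_div_mul_cancel hα.ne', Real.rpow_one]

lemma scaledLaw_tail_eq {C : ℝ} (hα : 0 < α) (hβ : 0 < β) (hN : 0 < N)
    (htail : ∀ t : ℝ, 1 < t → ρ.real {y | t ≤ |y|} = C / t ^ α) {t : ℝ} (ht : 0 < t)
    (h : β / (N : ℝ) ^ (1 / α) < t) :
    (scaledLaw ρ α β N).real {y | t ≤ |y|} = C * (β / t) ^ α / N := by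
  have ha : 0 < β / (N : ℝ) ^ (1 / α) := by positivity
  have hN' : (0 : ℝ) < N := by exact_mod_cast hN
  have hb := Real.rpow_pos_of_pos hβ α
  have hta := Real.rpow_pos_of_pos ht α
  rw [scaledLaw_tail hβ hN, htail _ ((one_lt_div ha).2 h), Real.div_rpow ht.le ha.le,
    scale_rpow hα hβ, Real.div_rpow hβ.le ht.le]
  field_simp

variable [IsProbabilityMeasure ρ]

lemma scaledLaw_tail_le {C : ℝ} (hα : 0 < α) (hβ : 0 < β) (hC : 0 < C) (hN : 0 < N)
    (htail : ∀ t : ℝ, 1 < t → ρ.real {y | t ≤ |y|} = C / t ^ α) (t : ℝ) (ht : 0 < t) :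
    (scaledLaw ρ α β N).real {y | t ≤ |y|} ≤ (1 + C) * (β ^ α / N) * t ^ (-α) := by
  have ha : 0 < β / (N : ℝ) ^ (1 / α) := by positivity
  rw [scaledLaw_tail hβ hN]
  refine (tail_le hα hC htail _ (div_pos ht ha)).trans_eq ?_
  rw [Real.div_rpow ht.le ha.le, Real.rpow_neg ha.le, scale_rpow hα hβ, div_inv_eq_mul]
  ring

/-- After truncation at `δ`, the scaled couplings form a diluted model with a coupling law that
does not depend on the size of the system. -/
lemma exists_scaledLaw_map_trunc_eq_mixture {C δ : ℝ} (hα : 0 < α) (hβ : 0 < β) (hC : 0 < C)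
    (hδ : 0 < δ) (hρ : MeasurePreserving (fun y : ℝ => -y) ρ ρ) (hρi : Integrable (fun y => y) ρ)
    (htail : ∀ t : ℝ, 1 < t → ρ.real {y | t ≤ |y|} = C / t ^ α) :
    ∃ μ : Measure ℝ, IsProbabilityMeasure μ ∧ MeasurePreserving (fun y : ℝ => -y) μ μ ∧
      Integrable (fun y => y) μ ∧ ∀ᶠ N : ℕ in atTop,
        (scaledLaw ρ α β N).map (trunc δ) = mixture (C * (β / δ) ^ α / N) μ := by
  set c := C * (β / δ) ^ α with hc
  have hc0 : 0 < c := by positivity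
  set A : Set ℝ := {y | δ ≤ |y|} with hA
  have hAm : MeasurableSet A := measurableSet_le_abs δ
  have hev : ∀ᶠ N : ℕ in atTop, 0 < N ∧ β / (N : ℝ) ^ (1 / α) < δ := by
    have h1 : Tendsto (fun N : ℕ => β / (N : ℝ) ^ (1 / α)) atTop (𝓝 0) :=
      tendsto_const_nhds.div_atTop
        ((tendsto_rpow_atTop (one_div_pos.2 hα)).comp tendsto_natCast_atTop_atTop)
    filter_upwards [eventually_gt_atTop 0, h1.eventually_lt_const hδ] with N h2 h3
    exact ⟨h2, h3⟩
  obtain ⟨N₀, hN₀, hN₀δ⟩ := hev.exists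
  -- Multiplying by `N / c` removes `N` from the tail beyond `δ`. The restriction to `A` is then the
  -- same probability measure for all large `N`, and any admissible `N₀` can serve to define it.
  set κ : ℕ → Measure ℝ := fun N => ENNReal.ofReal (N / c) • scaledLaw ρ α β N with hκ
  have hfin : ∀ N, IsFiniteMeasure (κ N) := fun N =>
    Measure.smul_finite _ ENNReal.ofReal_ne_top
  have hsymm : ∀ N, MeasurePreserving (fun y : ℝ => -y) (κ N) (κ N) := fun N =>
    (measurePreserving_neg_scaledLaw α β N hρ).smul_measure _
  have htailκ : ∀ N : ℕ, 0 < N → β / (N : ℝ) ^ (1 / α) < δ → ∀ t, δ ≤ t →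
      (κ N).real {y | t ≤ |y|} = C * (β / t) ^ α / c := fun N hN hNδ t ht => by
    have hN' : (0 : ℝ) < N := by exact_mod_cast hN
    rw [hκ, measureReal_ennreal_smul_apply, ENNReal.toReal_ofReal (by positivity),
      scaledLaw_tail_eq hα hβ hN htail (hδ.trans_le ht) (hNδ.trans_le ht)]
    field_simp
  have hscale : ∀ N : ℕ, 0 < N →
      (scaledLaw ρ α β N).restrict A = ENNReal.ofReal (c / N) • (κ N).restrict A := fun N hN => by
    have hN' : (0 : ℝ) < N := by exact_mod_cast hN
    rw [hκ, Measure.restrict_smul, smul_smul, ← ENNReal.ofReal_mul (by positivity)]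
    have : c / N * (N / c) = 1 := by field_simp
    rw [this, ENNReal.ofReal_one, one_smul]
  refine ⟨(κ N₀).restrict A, ⟨?_⟩, ?_, ?_, ?_⟩
  · rw [Measure.restrict_apply_univ, ← ofReal_measureReal, htailκ N₀ hN₀ hN₀δ δ le_rfl, ← hc,
      div_self hc0.ne', ENNReal.ofReal_one]
  · have h := (hsymm N₀).restrict_preimage hAm
    have hpre : (fun y : ℝ => -y) ⁻¹' A = A := by
      ext y
      simp [hA]
    rwa [hpre] at h
  · exact ((integrable_scaledLaw α β N₀ hρi).smul_measure ENNReal.ofReal_ne_top).restrict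
  · filter_upwards [hev] with N hN
    have hN' : (0 : ℝ) < N := by exact_mod_cast hN.1
    have hmass : (scaledLaw ρ α β N) Aᶜ = ENNReal.ofReal (1 - c / N) := by
      rw [← ofReal_measureReal, probReal_compl_eq_one_sub hAm,
        scaledLaw_tail_eq hα hβ hN.1 htail hδ hN.2]
    rw [map_trunc_eq, hmass, hscale N hN.1, restrict_eq_of_tail_eq (hsymm N) (hsymm N₀) hδ
      fun t ht => by rw [htailκ N hN.1 hN.2 t ht, htailκ N₀ hN₀ hN₀δ t ht]]
    rfl

/-- Up to an error of order `δ ^ (2 - α)`, the free energy is that of a diluted model. -/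
lemma exists_tendsto_near_free_energy {C δ : ℝ} (hα : 1 < α) (hα' : α < 2) (hβ : 0 < β)
    (hC : 0 < C) (hδ : 0 < δ) (hρ : MeasurePreserving (fun y : ℝ => -y) ρ ρ)
    (htail : ∀ t : ℝ, 1 < t → ρ.real {y | t ≤ |y|} = C / t ^ α) :
    ∃ (u : ℕ → ℝ) (L : ℝ), Tendsto u atTop (𝓝 L) ∧ ∀ᶠ N : ℕ in atTop,
      |(∫ x, logZ x ∂(Measure.pi fun _ : Pairs N => scaledLaw ρ α β N)) / N - u N| ≤
        (1 + C) * β ^ α / (2 - α) * δ ^ (2 - α) := by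
  have hα0 : 0 < α := zero_lt_one.trans hα
  have hρi := integrable_of_tail hα htail
  obtain ⟨μ, hμp, hμs, hμi, hμ⟩ :=
    exists_scaledLaw_map_trunc_eq_mixture hα0 hβ hC hδ hρ hρi htail
  set c := C * (β / δ) ^ α with hc
  have hc0 : 0 ≤ c := by positivity
  obtain ⟨L, hL⟩ := exists_tendsto_dilutedMean hμs hμi hc0
  refine ⟨_, L, hL, ?_⟩
  filter_upwards [hμ, eventually_gt_atTop 0] with N hN hN0
  have hN' : (0 : ℝ) < N := by exact_mod_cast hN0
  have h1 := abs_integral_logZ_sub_trunc_le (N := N) (scaledLaw ρ α β N)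
    (measurePreserving_neg_scaledLaw α β N hρ) (integrable_scaledLaw α β N hρi) δ
  have h2 : ∫ x, logZ (fun p => trunc δ (x p))
      ∂(Measure.pi fun _ : Pairs N => scaledLaw ρ α β N) = dilutedMean μ c N := by
    have hprob : IsProbabilityMeasure ((scaledLaw ρ α β N).map (trunc δ)) :=
      Measure.isProbabilityMeasure_map (measurable_trunc δ).aemeasurable
    have hmap := Measure.pi_map_pi (μ := fun _ : Pairs N => scaledLaw ρ α β N)
      (f := fun _ => trunc δ) fun _ => (measurable_trunc δ).aemeasurable
    have hmeas : Measurable fun (x : Pairs N → ℝ) p => trunc δ (x p) :=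
      measurable_pi_lambda _ fun p => (measurable_trunc δ).comp (measurable_pi_apply p)
    rw [← integral_map hmeas.aemeasurable continuous_logZ.aestronglyMeasurable, hmap, hN]
    rfl
  have h3 := integral_sub_trunc_sq_le hα' (scaledLaw_tail_le hα0 hβ hC hN0 htail) hδ
  rw [h2, integral_div] at h1
  rw [← sub_div, abs_div, abs_of_pos hN', div_le_iff₀ hN']
  refine h1.trans ?_
  have h4 : (∫ y, (y - trunc δ y) ^ 2 ∂(scaledLaw ρ α β N)) / 2 ≤
      (1 + C) * (β ^ α / N) * (δ ^ (2 - α) / (1 - α / 2)) / 2 := by linarith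
  have h5 : 0 ≤ (∫ y, (y - trunc δ y) ^ 2 ∂(scaledLaw ρ α β N)) / 2 :=
    div_nonneg (integral_nonneg fun _ => sq_nonneg _) zero_le_two
  -- At most `N ^ 2` pairs times a variance of order `1 / N` is of order `N`, which matches the
  -- normalization.
  refine (mul_le_mul (card_pairs_le N) h4 h5 (sq_nonneg _)).trans_eq ?_
  have h6 : (2 - α) ≠ 0 := by linarith
  have h7 : (1 - α / 2) = (2 - α) / 2 := by ring
  rw [h7]
  field_simp

end Scaled

/-! ### Convergence of the free energy -/

lemma exists_tendsto_of_near_convergent {f : ℕ → ℝ}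
    (h : ∀ ε > 0, ∃ (u : ℕ → ℝ) (L : ℝ), Tendsto u atTop (𝓝 L) ∧ ∀ᶠ n in atTop, |f n - u n| ≤ ε) :
    ∃ L, Tendsto f atTop (𝓝 L) := by
  refine cauchySeq_tendsto_of_complete (Metric.cauchySeq_iff'.2 fun ε hε => ?_)
  -- Four errors of size `ε / 8` separate `f n` from `f n₀`, along `u n`, `L` and `u n₀`.
  obtain ⟨u, L, hu, hev⟩ := h (ε / 8) (by positivity)
  obtain ⟨n₀, hn₀⟩ := eventually_atTop.1
    (hev.and (hu.eventually (Metric.ball_mem_nhds L (show 0 < ε / 8 by positivity))))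
  refine ⟨n₀, fun n hn => ?_⟩
  have h1 := hn₀ n hn
  have h2 := hn₀ n₀ le_rfl
  simp only [Real.dist_eq] at h1 h2
  rw [Real.dist_eq, abs_lt]
  have a1 := abs_le.1 h1.1
  have a2 := abs_lt.1 h1.2
  have a3 := abs_le.1 h2.1
  have a4 := abs_lt.1 h2.2
  constructor <;> linarith

lemma exists_tendsto_free_energy {ρ : Measure ℝ} [IsProbabilityMeasure ρ] {α β C : ℝ} (hα : 1 < α)
    (hα' : α < 2) (hβ : 0 < β) (hC : 0 < C) (hρ : MeasurePreserving (fun y : ℝ => -y) ρ ρ)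
    (htail : ∀ t : ℝ, 1 < t → ρ.real {y | t ≤ |y|} = C / t ^ α) :
    ∃ F, Tendsto (fun N : ℕ =>
      (∫ x, logZ x ∂(Measure.pi fun _ : Pairs N => scaledLaw ρ α β N)) / N) atTop (𝓝 F) := by
  refine exists_tendsto_of_near_convergent fun ε hε => ?_
  have h2α : 0 < 2 - α := by linarith
  set K := (1 + C) * β ^ α / (2 - α) with hK
  have hK0 : 0 < K := by positivity
  -- This cutoff solves `K * δ ^ (2 - α) = ε`.
  have hδ : 0 < (ε / K) ^ (1 / (2 - α)) := by positivity
  have hε' : K * ((ε / K) ^ (1 / (2 - α))) ^ (2 - α) = ε := by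
    rw [← Real.rpow_mul (by positivity), one_div_mul_cancel h2α.ne', Real.rpow_one]
    field_simp
  have h := exists_tendsto_near_free_energy hα hα' hβ hC hδ hρ htail
  rwa [← hK, hε'] at h

/-- Only the joint law of the couplings matters, so the arbitrary probability spaces are replaced by
a product measure on `Pairs N → ℝ`. -/
lemma map_scaled_eq_pi {N : ℕ} {Ω : Type*} [MeasurableSpace Ω] {P : Measure Ω}
    [IsProbabilityMeasure P] {J : Pairs N → Ω → ℝ} {ρ : Measure ℝ} [IsProbabilityMeasure ρ]
    (hm : ∀ p, AEMeasurable (J p) P) (hindep : iIndepFun J P) (hlaw : ∀ p, P.map (J p) = ρ)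
    (α β : ℝ) :
    P.map (fun ω p => β / (N : ℝ) ^ (1 / α) * J p ω) =
      Measure.pi fun _ : Pairs N => scaledLaw ρ α β N := by
  have h1 := (iIndepFun_iff_map_fun_eq_pi_map hm).1 hindep
  simp only [hlaw] at h1
  have hprob : IsProbabilityMeasure (ρ.map fun y => β / (N : ℝ) ^ (1 / α) * y) :=
    isProbabilityMeasure_scaledLaw α β N
  have h2 := Measure.pi_map_pi (μ := fun _ : Pairs N => ρ)
    (f := fun _ y => β / (N : ℝ) ^ (1 / α) * y) fun _ => (measurable_const_mul _).aemeasurable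
  have hmeas : Measurable fun (x : Pairs N → ℝ) p => β / (N : ℝ) ^ (1 / α) * x p :=
    measurable_pi_lambda _ fun p => (measurable_pi_apply p).const_mul _
  rw [← h1, AEMeasurable.map_map_of_aemeasurable hmeas.aemeasurable
    (aemeasurable_pi_lambda _ hm)] at h2
  exact h2

end HeavyTailedSpinGlass

end

theorem theorem1
    (α β C₀ : ℝ) (hα : 1 < α) (hα' : α < 2) (hβ : 0 < β) (hC₀ : 0 < C₀)
    -- the reference variable `J₀`: symmetric, with exact power law tail
    {Ω₀ : Type*} [MeasurableSpace Ω₀] (P₀ : Measure Ω₀) [IsProbabilityMeasure P₀]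
    (J₀ : Ω₀ → ℝ)
    (hsymm : IdentDistrib J₀ (fun ω => -J₀ ω) P₀ P₀)
    (htail : ∀ t : ℝ, 1 < t → P₀.real {ω | t ≤ |J₀ ω|} = C₀ / t ^ α)
    -- for each `N`, i.i.d. couplings `J N p`, `p = (i, j)` with `i < j`, distributed as `J₀`
    {Ω : ℕ → Type*} [∀ N, MeasurableSpace (Ω N)] (P : ∀ N, Measure (Ω N))
    [∀ N, IsProbabilityMeasure (P N)]
    (J : ∀ N, HeavyTailedSpinGlass.Pairs N → Ω N → ℝ)
    (hindep : ∀ N, iIndepFun (J N) (P N))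
    (hdist : ∀ N p, IdentDistrib (J N p) J₀ (P N) P₀) :
    (∀ N, Integrable
      (fun ω => Real.log (HeavyTailedSpinGlass.partitionFunction α β (fun p => J N p ω)))
      (P N)) ∧
    ∃ F : ℝ, Tendsto (fun N => HeavyTailedSpinGlass.freeEnergy α β (P N) (J N)) atTop (𝓝 F) := by
  have hm₀ : AEMeasurable J₀ P₀ := hsymm.aemeasurable_fst
  set ρ : Measure ℝ := P₀.map J₀ with hρdef
  have hρprob : IsProbabilityMeasure ρ := Measure.isProbabilityMeasure_map hm₀
  have hρsymm : MeasurePreserving (fun y : ℝ => -y) ρ ρ := by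
    refine ⟨measurable_neg, ?_⟩
    have h := hsymm.map_eq
    rw [hρdef, AEMeasurable.map_map_of_aemeasurable measurable_neg.aemeasurable hm₀]
    exact h.symm
  have hρtail : ∀ t : ℝ, 1 < t → ρ.real {y | t ≤ |y|} = C₀ / t ^ α := fun t ht => by
    rw [← htail t ht, hρdef, measureReal_def,
      Measure.map_apply_of_aemeasurable hm₀ (HeavyTailedSpinGlass.measurableSet_le_abs t)]
    rfl
  have hm : ∀ N p, AEMeasurable (J N p) (P N) := fun N p => (hdist N p).aemeasurable_fst
  have hmap : ∀ N, (P N).map (fun ω p => β / (N : ℝ) ^ (1 / α) * J N p ω) =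
      Measure.pi fun _ : HeavyTailedSpinGlass.Pairs N => HeavyTailedSpinGlass.scaledLaw ρ α β N :=
    fun N =>
    HeavyTailedSpinGlass.map_scaled_eq_pi (hm N) (hindep N) (fun p => (hdist N p).map_eq) α β
  have hmN : ∀ N : ℕ, AEMeasurable (fun ω p => β / (N : ℝ) ^ (1 / α) * J N p ω) (P N) := fun N =>
    aemeasurable_pi_lambda _ fun p => (hm N p).const_mul _
  have hρi := HeavyTailedSpinGlass.integrable_of_tail hα hρtail
  simp only [HeavyTailedSpinGlass.freeEnergy, HeavyTailedSpinGlass.log_partitionFunction]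
  refine ⟨fun N => ?_, ?_⟩
  · have h := HeavyTailedSpinGlass.integrable_logZ
      (fun _ : HeavyTailedSpinGlass.Pairs N => HeavyTailedSpinGlass.scaledLaw ρ α β N)
      fun _ => HeavyTailedSpinGlass.integrable_scaledLaw α β N hρi
    rwa [← hmap N, integrable_map_measure
      HeavyTailedSpinGlass.continuous_logZ.aestronglyMeasurable (hmN N)] at h
  · obtain ⟨F, hF⟩ := HeavyTailedSpinGlass.exists_tendsto_free_energy hα hα' hβ hC₀ hρsymm hρtail
    refine ⟨F, hF.congr fun N => ?_⟩
    rw [← hmap N, integral_map (hmN N) HeavyTailedSpinGlass.continuous_logZ.aestronglyMeasurable]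
    ring
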